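/- Let $A=e^{i\pi/4}$, $\Phi=\{z\in\mathbb C: z^8=1\}$, and let $PM_{m\times k}(\mathbb Z)$ be the set of integer $m\times k$ matrices modulo multiplication by $\pm1$; the class of $M$ is regarded as the set $\{M,-M\}$. For a link diagram $L$, let $\langle L\rangle=\sum_\sigma A^{\alpha(\sigma)-\beta(\sigma)}(-A^2-A^{-2})^{d(\sigma)-1}$ be its Kauffman bracket at $A$, where $\sigma$ runs over all states (a choice of an $A$-type or $B$-type splitting at every crossing), $\alpha(\sigma)$ and $\beta(\sigma)$ are the numbers of $A$-type and $B$-type splittings, and $d(\sigma)$ is the number of circles after splitting. An $n$-punctured ball tangle diagram $T$ (with all $m_k=2$) is a planar diagram, with over/under crossings, in a disk with $n$ numbered round holes removed; the outer circle and each of the $n$ inner circles carry exactly four end points NW, SW, SE, NE. For $j\in\{1,2\}$ and $\alpha\in\{1,2\}^n$ let $T_{j\alpha}$ be the link diagram obtained by filling the $k$-th hole with the crossingless tangle joining NW–SW and NE–SE if $\alpha_k=1$, respectively NW–NE and SW–SE if $\alpha_k=2$, for every $k$, and by closing up outside the outer circle with arcs joining NW–NE and SW–SE if $j=1$ (numerator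 closure), respectively NW–SW and NE–SE if $j=2$ (denominator closure). Let $\alpha^n_1<\dots<\alpha^n_{2^n}$ be the elements of $\{1,2\}^n$ in lexicographic order, and let $t_i$ be the number of entries of $\alpha_i^n$ equal to $2$ (equivalently, $(t_1,\dots,t_{2^n})=a_n$, where $a_0=(0)$ and $a_{k+1}$ is $a_k$ followed by $a_k$ with every entry increased by $1$). Two such diagrams are isotopic if they are related by a finite sequence of planar isotopies and tangle Reidemeister moves, i.e. the usual Reidemeister moves I, II, III and the move IV, which passes a strand over or under a hole. Diagrams are considered up to planar isotopy, as planar maps with numbered holes and labelled end points. **Theorem.** For every $n\ge 0$ and every $n$-punctured ball tangle diagram $T$, the set $$F^n(T)=\left\{\begin{pmatrix}(-i)^{t_1}z\langle T_{1\alpha_1^n}\rangle&\cdots&(-i)^{t_{2^n}}z\langle T_{1\alpha_{2^n}^n}\rangle\\(-i)^{t_1}iz\langle T_{2\alpha_1^n}\rangle&\cdots&(-i)^{t_{2^n}}iz\langle T_{2\alpha_{2^n}^n}\rangle\end{pmatrix}: z\in\Phi\right\}\cap M_{2\times2^n}(\mathbb Z)$$ is an element of $PM_{2\times 2^n}(\mathbb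 Z)$, i.e. it is of the form $\{M,-M\}$. If $T$ and $T'$ are isotopic $n$-punctured ball tangle diagrams, then $F^n(T)=F^n(T')$. For $n=0$, $F^0$ is Krebes' ball tangle invariant: $F^0(B)=\left\{\begin{pmatrix}z\langle B_1\rangle\\ iz\langle B_2\rangle\end{pmatrix}: z\in\Phi\right\}\cap M_{2\times1}(\mathbb Z)$, where $B_1$ and $B_2$ are the numerator and the denominator closure of $B$. -/

import Mathlib

/-!
Diagrams of `n`-punctured ball tangles (every boundary sphere carrying four points), up to planar
isotopy, are encoded as planar four-valent maps.  Every crossing, every hole and the outer boundary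
circle contributes four ends ("darts"); arcs may moreover carry auxiliary marked points (with two
darts each), so that a closed curve without crossings is an arc through at least one marked point.
The arcs of the diagram pair off the darts.
-/

namespace PuncturedTangle

/-- A perfect matching of the elements of `D`: a fixed-point-free involution. -/
structure Pairing (D : Type) where
  e : D → D
  e_e : ∀ d, e (e d) = d
  e_ne : ∀ d, e d ≠ d

/-- Transport of a matching along a bijection. -/
def Pairing.map {D D' : Type} (w : Pairing D) (f : D ≃ D') : Pairing D' where
  e d := f (w.e (f.symm d))
  e_e d := by simp [w.e_e]
  e_ne d h := w.e_ne (f.symm d) (by rw [Equiv.eq_symm_apply]; exact h)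

/-- Disjoint union of two matchings. -/
def Pairing.sum {D D' : Type} (w : Pairing D) (w' : Pairing D') : Pairing (D ⊕ D') where
  e := Sum.map w.e w'.e
  e_e d := by cases d <;> simp [w.e_e, w'.e_e]
  e_ne d h := by
    cases d with
    | inl d => exact w.e_ne d (Sum.inl.inj h)
    | inr d => exact w'.e_ne d (Sum.inr.inj h)

/-- Darts of a diagram with crossings `X`, marked points `P`, holes `H` and boundary slots `B`.
* The darts at a crossing are numbered counterclockwise; `0` and `2` form the over-strand.
* The darts at a hole are numbered counterclockwise, starting at the upper left:
  `0 = NW`, `1 = SW`, `2 = SE`, `3 = NE`.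
* The slots are the ends of arcs on the outer boundary. -/
inductive Dart (X P H B : Type) : Type
  | crossing (x : X) (k : Fin 4) : Dart X P H B
  | point (p : P) (k : Fin 2) : Dart X P H B
  | hole (h : H) (k : Fin 4) : Dart X P H B
  | slot (b : B) : Dart X P H B

/-- A piece of a diagram: the arcs join the darts in pairs. -/
abbrev Wiring (X P H B : Type) : Type := Pairing (Dart X P H B)

/-! ### Link diagrams and the Kauffman bracket at `A = exp (iπ/4)` -/

/-- A link diagram: no holes and no outer boundary. -/
abbrev LinkWiring (X P : Type) : Type := Wiring X P Empty Empty

/-- The reconnection of the darts produced by a state: `true` is the `A`-type splitting, `false`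
the `B`-type splitting.  Turning the over-strand (darts `0`, `2`) counterclockwise sweeps the
regions between the darts `0, 1` and between `2, 3`; these are the `A`-regions.  The `A`-type
splitting joins them, so it connects `0` with `3` and `1` with `2`. -/
def splice {X P : Type} (σ : X → Bool) : Dart X P Empty Empty → Dart X P Empty Empty
  | .crossing x k => .crossing x (if σ x then ![3, 2, 1, 0] k else ![1, 0, 3, 2] k)
  | .point p k => .point p (k + 1)

/-- The number of circles of the crossingless diagram obtained from `L` by the state `σ`. -/
noncomputable def circles {X P : Type} (L : LinkWiring X P) (σ : X → Bool) : ℕ :=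
  Nat.card (Quot fun d d' : Dart X P Empty Empty => d' = L.e d ∨ d' = splice σ d)

/-- `A = exp (iπ/4)`. -/
noncomputable def A : ℂ := Complex.exp (Complex.I * Real.pi / 4)

/-- The Kauffman bracket at `A` of a (nonempty) link diagram. -/
noncomputable def bracket {X P : Type} [Fintype X] [DecidableEq X] (L : LinkWiring X P) : ℂ :=
  ∑ σ : X → Bool,
    A ^ (Finset.univ.filter fun x => σ x = true).card *
      (A⁻¹) ^ (Finset.univ.filter fun x => σ x = false).card *
      (-A ^ 2 - (A⁻¹) ^ 2) ^ (circles L σ - 1)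

/-! ### Diagrams of punctured ball tangles -/

/-- The next dart in the cyclic order at a vertex of the spherical map obtained by collapsing the
exterior of the outer circle to a vertex.  The slots `0 = NW`, `1 = SW`, `2 = SE`, `3 = NE` on the
outer circle are numbered counterclockwise as seen from its centre, hence clockwise around that
vertex. -/
def rot {X P : Type} {n : ℕ} : Dart X P (Fin n) (Fin 4) → Dart X P (Fin n) (Fin 4)
  | .crossing x k => .crossing x (k + 1)
  | .point p k => .point p (k + 1)
  | .hole h k => .hole h (k + 1)
  | .slot b => .slot (b - 1)

/-- Planarity: `vertices - edges + faces = 2 * (connected components)`, i.e. every connected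
component of the map has genus `0`. -/
def IsPlanar {X P : Type} {n : ℕ} (w : Wiring X P (Fin n) (Fin 4)) : Prop :=
  Nat.card (Quot fun d d' => d' = rot (X := X) (P := P) (n := n) d) +
      Nat.card (Quot fun d d' => d' = rot (w.e d)) =
    Nat.card (Quot fun d d' => d' = w.e d) +
      2 * Nat.card (Quot fun d d' => d' = rot d ∨ d' = w.e d)

/-- A diagram of an `n`-punctured ball tangle with `m₀ = m₁ = ⋯ = mₙ = 2`. -/
structure Diagram (n : ℕ) where
  X : Type
  P : Type
  [fintypeX : Fintype X]
  [decEqX : DecidableEq X]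
  [fintypeP : Fintype P]
  wiring : Wiring X P (Fin n) (Fin 4)
  planar : IsPlanar wiring

attribute [instance] Diagram.fintypeX Diagram.decEqX Diagram.fintypeP

/-! ### Closures -/

/-- Two arcs joining `NW` with `SW` (dart `0` with `1`) and `SE` with `NE` (dart `2` with `3`).
A dart is sent to the arc it lies on and to its position on that arc. -/
def verticalArcs : Fin 4 ≃ Fin 2 × Fin 2 where
  toFun := ![(0, 0), (0, 1), (1, 0), (1, 1)]
  invFun q := ![![0, 1], ![2, 3]] q.1 q.2
  left_inv := by decide
  right_inv := by decide

/-- Two arcs joining `NW` with `NE` (dart `0` with `3`) and `SW` with `SE` (dart `1` with `2`). -/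
def horizontalArcs : Fin 4 ≃ Fin 2 × Fin 2 where
  toFun := ![(0, 0), (1, 0), (1, 1), (0, 1)]
  invFun q := ![![0, 3], ![1, 2]] q.1 q.2
  left_inv := by decide
  right_inv := by decide

/-- The two fundamental tangles that are put into the holes; the index `0` stands for the
fundamental tangle `1` (whose numerator closure is one circle), the index `1` for the fundamental
tangle `2` (whose denominator closure is one circle). -/
def fundamentalTangle : Fin 2 → (Fin 4 ≃ Fin 2 × Fin 2) := ![verticalArcs, horizontalArcs]

/-- The exterior arcs of the closures; the index `0` stands for the numerator closure (subscript
`1`), the index `1` for the denominator closure (subscript `2`). -/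
def closingArcs : Fin 2 → (Fin 4 ≃ Fin 2 × Fin 2) := ![horizontalArcs, verticalArcs]

/-- Every arc put into a hole or outside of the outer circle becomes a marked point of the closed
up diagram. -/
def closureDarts {X P : Type} {n : ℕ} (j : Fin 2) (α : Fin n → Fin 2) :
    Dart X P (Fin n) (Fin 4) ≃ Dart X (P ⊕ (Fin n × Fin 2) ⊕ Fin 2) Empty Empty where
  toFun
    | .crossing x k => .crossing x k
    | .point p k => .point (.inl p) k
    | .hole h k =>
        .point (.inr (.inl (h, (fundamentalTangle (α h) k).1))) (fundamentalTangle (α h) k).2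
    | .slot b => .point (.inr (.inr (closingArcs j b).1)) (closingArcs j b).2
  invFun
    | .crossing x k => .crossing x k
    | .point (.inl p) k => .point p k
    | .point (.inr (.inl q)) k => .hole q.1 ((fundamentalTangle (α q.1)).symm (q.2, k))
    | .point (.inr (.inr s)) k => .slot ((closingArcs j).symm (s, k))
  left_inv d := by rcases d with _ | _ | _ | _ <;> simp
  right_inv d := by rcases d with _ | ⟨_ | _ | _, _⟩ | ⟨⟨⟩, _⟩ | ⟨⟨⟩⟩ <;> simp

/-- The link diagram obtained from `T` by putting the fundamental tangle `α h` into every hole `h`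
and taking the numerator (`j = 0`) or denominator (`j = 1`) closure. -/
def Diagram.closure {n : ℕ} (T : Diagram n) (j : Fin 2) (α : Fin n → Fin 2) :
    LinkWiring T.X (T.P ⊕ (Fin n × Fin 2) ⊕ Fin 2) :=
  T.wiring.map (closureDarts j α)

/-! ### Matrices modulo sign and the invariant -/

/-- Two integer matrices are identified if they agree up to a global sign. -/
def signSetoid (m k : ℕ) : Setoid (Matrix (Fin m) (Fin k) ℤ) where
  r M N := M = N ∨ M = -N
  iseqv :=
    { refl := fun _ => Or.inl rfl
      symm := by
        rintro M N (h | h)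
        · exact Or.inl h.symm
        · exact Or.inr (by rw [h, neg_neg])
      trans := by
        rintro M N K (rfl | rfl) (rfl | rfl)
        · exact Or.inl rfl
        · exact Or.inr rfl
        · exact Or.inr rfl
        · exact Or.inl (neg_neg _) }

/-- `PM_{m × k}(ℤ)`: integer matrices modulo multiplication by `±1`. -/
def PM (m k : ℕ) : Type := Quotient (signSetoid m k)

/-- An element of `PM_{m × k}(ℤ)`, regarded as the set `{M, -M}` of its representatives. -/
def PM.matrices {m k : ℕ} (c : PM m k) : Set (Matrix (Fin m) (Fin k) ℤ) :=
  {M | (Quotient.mk (signSetoid m k) M : PM m k) = c}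

/-- The eighth roots of unity. -/
def Phi : Set ℂ := {z | z ^ 8 = 1}

/-- The sequences `a₀ = (0)`, `aₖ₊₁ = (aₖ, aₖ + 1)` of exponents. -/
def tSeq : ℕ → List ℕ
  | 0 => [0]
  | k + 1 => tSeq k ++ (tSeq k).map (· + 1)

/-- The `i`-th element, in lexicographic order, of `{1, 2}ⁿ` (written as `{0, 1}ⁿ`): the `n` binary
digits of `i`, the most significant one first. -/
def alpha (n : ℕ) (i : Fin (2 ^ n)) : Fin n → Fin 2 :=
  fun k => finFunctionFinEquiv.symm i k.rev

/-- The matrix `X(T)` with first row `(-i)^{tᵢ} ⟨T_{1 αᵢ}⟩` and second row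
`(-i)^{tᵢ} i ⟨T_{2 αᵢ}⟩`. -/
noncomputable def Diagram.bracketMatrix {n : ℕ} (T : Diagram n) :
    Matrix (Fin 2) (Fin (2 ^ n)) ℂ :=
  Matrix.of fun j i =>
    (-Complex.I) ^ ((tSeq n).getD i 0) * Complex.I ^ (j : ℕ) * bracket (T.closure j (alpha n i))

/-- `{z X(T) | z ∈ Φ} ∩ M_{2 × 2ⁿ}(ℤ)`. -/
def Diagram.invariantSet {n : ℕ} (T : Diagram n) : Set (Matrix (Fin 2) (Fin (2 ^ n)) ℤ) :=
  {M | ∃ z ∈ Phi, M.map (Int.cast : ℤ → ℂ) = z • T.bracketMatrix}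

/-- The numerator (`j = 0`) and denominator (`j = 1`) closures of a ball tangle diagram. -/
def ballClosure (T : Diagram 0) (j : Fin 2) :
    LinkWiring T.X (T.P ⊕ (Fin 0 × Fin 2) ⊕ Fin 2) :=
  T.closure j Fin.elim0

/-- Krebes' invariant of a ball tangle diagram `T`, as a set of integer matrices:
`{(z ⟨T₁⟩, i z ⟨T₂⟩)ᵗ | z ∈ Φ} ∩ M_{2 × 1}(ℤ)`. -/
def krebesSet (T : Diagram 0) : Set (Matrix (Fin 2) (Fin 1) ℤ) :=
  {M | ∃ z ∈ Phi, M.map (Int.cast : ℤ → ℂ) =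
    !![z * bracket (ballClosure T 0); Complex.I * z * bracket (ballClosure T 1)]}

/-! ### Isotopy of diagrams: planar isotopy and the tangle Reidemeister moves I, II, III, IV -/

/-- A map of darts that respects the vertices: crossings go to crossings (preserving the cyclic
order and the over-strand, so up to a half turn), marked points to marked points, the legs of a hole
`i` to the corresponding legs of the hole `h i`, and every slot to itself. -/
structure Respects {X P H X' P' H' B : Type} (h : H → H')
    (φ : Dart X P H B → Dart X' P' H' B) : Prop where
  crossing : ∀ x, ∃ x', (∀ k, φ (.crossing x k) = .crossing x' k) ∨
    (∀ k, φ (.crossing x k) = .crossing x' (k + 2))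
  point : ∀ p, ∃ p', (∀ k, φ (.point p k) = .point p' k) ∨
    (∀ k, φ (.point p k) = .point p' (k + 1))
  hole : ∀ i k, φ (.hole i k) = .hole (h i) k
  slot : ∀ b, φ (.slot b) = .slot b

/-- Two pieces of diagrams agree up to naming of the crossings and points, the holes being
identified by `h`. -/
def Iso {X P H X' P' H' B : Type} (h : H ≃ H') (w : Wiring X P H B) (w' : Wiring X' P' H' B) :
    Prop :=
  ∃ φ : Dart X P H B ≃ Dart X' P' H' B, Respects h φ ∧ ∀ d, φ (w.e d) = w'.e (φ d)

/-- `w'` is obtained from `w` by placing one additional marked point `p` on the arc that joins the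
darts `d₀` and `w.e d₀`. -/
def Subdivides {X P H X' P' B : Type} (w : Wiring X P H B) (w' : Wiring X' P' H B) : Prop :=
  ∃ (φ : Dart X P H B → Dart X' P' H B) (p : P') (d₀ : Dart X P H B),
    Function.Injective φ ∧ Respects id φ ∧
    (∀ y, (∃ d, φ d = y) ↔ ∀ k, y ≠ .point p k) ∧
    w'.e (.point p 0) = φ d₀ ∧ w'.e (.point p 1) = φ (w.e d₀) ∧
    ∀ d, d ≠ d₀ → d ≠ w.e d₀ → w'.e (φ d) = φ (w.e d)

/-- Splitting the darts of a composed diagram.  A slot in `B`, where the inner piece is attached to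
the outer one, is a marked point of the composed diagram, with its dart `0` in the outer piece and
its dart `1` in the inner piece. -/
def glueDarts (X P H X' P' H' B₀ B : Type) :
    Dart X P H (B₀ ⊕ B) ⊕ Dart X' P' H' B ≃ Dart (X ⊕ X') (P ⊕ P' ⊕ B) (H ⊕ H') B₀ where
  toFun
    | .inl (.crossing x k) => .crossing (.inl x) k
    | .inl (.point p k) => .point (.inl p) k
    | .inl (.hole h k) => .hole (.inl h) k
    | .inl (.slot (.inl b)) => .slot b
    | .inl (.slot (.inr b)) => .point (.inr (.inr b)) 0
    | .inr (.crossing x k) => .crossing (.inr x) k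
    | .inr (.point p k) => .point (.inr (.inl p)) k
    | .inr (.hole h k) => .hole (.inr h) k
    | .inr (.slot b) => .point (.inr (.inr b)) 1
  invFun
    | .crossing (.inl x) k => .inl (.crossing x k)
    | .crossing (.inr x) k => .inr (.crossing x k)
    | .point (.inl p) k => .inl (.point p k)
    | .point (.inr (.inl p)) k => .inr (.point p k)
    | .point (.inr (.inr b)) 0 => .inl (.slot (.inr b))
    | .point (.inr (.inr b)) 1 => .inr (.slot b)
    | .hole (.inl h) k => .inl (.hole h k)
    | .hole (.inr h) k => .inr (.hole h k)
    | .slot b => .inl (.slot (.inl b))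
  left_inv d := by rcases d with (_ | _ | _ | (_ | _)) | (_ | _ | _ | _) <;> rfl
  right_inv d := by
    rcases d with ⟨_ | _, _⟩ | ⟨_ | _ | _, k⟩ | ⟨_ | _, _⟩ | _ <;> first | rfl | (fin_cases k <;> rfl)

/-- Attaching an inner piece with slots `B` to an outer piece. -/
def glue {X P H X' P' H' B₀ B : Type} (K : Wiring X P H (B₀ ⊕ B)) (Q : Wiring X' P' H' B) :
    Wiring (X ⊕ X') (P ⊕ P' ⊕ B) (H ⊕ H') B₀ :=
  (K.sum Q).map (glueDarts X P H X' P' H' B₀ B)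

/-- The darts in each of the listed pairs are joined by an arc. -/
def HasArcs {X P H B : Type} (w : Wiring X P H B)
    (l : List (Dart X P H B × Dart X P H B)) : Prop :=
  ∀ q ∈ l, w.e q.1 = q.2

/-- A horizontal strand (crossings `a` on the right and `b` on the left) passes north of a
four-valent vertex with legs `v 0 = NE`, `v 1 = NW`, `v 2 = SW`, `v 3 = SE`.  The slots are, in
counterclockwise order, `0 = E`, `1 = NE`, `2 = NW`, `3 = W`, `4 = SW`, `5 = SE`.  The dart `a (0 + r)`
points east, `a (1 + r)` north, `a (2 + r)` west, `a (3 + r)` south, and similarly for `b`; so the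
strand passes over for even `r` and under for odd `r`. -/
def PassesNorth {X P H : Type} (w : Wiring X P H (Fin 6)) (r : Fin 4) (a b : X)
    (v : Fin 4 → Dart X P H (Fin 6)) : Prop :=
  HasArcs w
    [(.crossing a (0 + r), .slot 0), (.crossing a (1 + r), .slot 1),
     (.crossing a (2 + r), .crossing b (0 + r)), (.crossing a (3 + r), v 0),
     (.crossing b (1 + r), .slot 2), (.crossing b (2 + r), .slot 3),
     (.crossing b (3 + r), v 1), (v 2, .slot 4), (v 3, .slot 5)]

/-- The same strand passes south of the vertex; now `a` is the crossing on the left and `b` the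
crossing on the right. -/
def PassesSouth {X P H : Type} (w : Wiring X P H (Fin 6)) (r : Fin 4) (a b : X)
    (v : Fin 4 → Dart X P H (Fin 6)) : Prop :=
  HasArcs w
    [(.crossing b (0 + r), .slot 0), (.crossing b (1 + r), v 3),
     (.crossing b (2 + r), .crossing a (0 + r)), (.crossing b (3 + r), .slot 5),
     (.crossing a (1 + r), v 2), (.crossing a (2 + r), .slot 3),
     (.crossing a (3 + r), .slot 4), (v 0, .slot 1), (v 1, .slot 2)]

/-- One elementary step between diagrams of `n`-punctured ball tangles.  In each of the
Reidemeister moves, `K` is the unchanged part of the diagram, and `Q` is replaced by `Q'`. -/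
inductive Move {n : ℕ} : Diagram n → Diagram n → Prop
  /-- Renaming of crossings and marked points. -/
  | rename (D D' : Diagram n) : Iso (Equiv.refl (Fin n)) D.wiring D'.wiring → Move D D'
  /-- Placing a marked point on an arc. -/
  | subdivide (D D' : Diagram n) : Subdivides D.wiring D'.wiring → Move D D'
  /-- Type I: a kink is removed from an arc. -/
  | typeI (D D' : Diagram n) {X P : Type} (K : Wiring X P (Fin n) (Fin 4 ⊕ Fin 2))
      (Q : Wiring (Fin 1) Empty Empty (Fin 2)) (Q' : Wiring Empty Empty Empty (Fin 2))
      (k : Fin 4) :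
      HasArcs Q [(.crossing 0 k, .crossing 0 (k + 1)), (.crossing 0 (k + 2), .slot 0),
        (.crossing 0 (k + 3), .slot 1)] →
      HasArcs Q' [(.slot 0, .slot 1)] →
      Iso (Equiv.sumEmpty (Fin n) Empty) (glue K Q) D.wiring →
      Iso (Equiv.sumEmpty (Fin n) Empty) (glue K Q') D'.wiring →
      Move D D'
  /-- Type II: a strand (from slot `0` to slot `3`) lying over or under another one (from slot `1`
  to slot `2`) is pulled off it.  The slots are numbered counterclockwise. -/
  | typeII (D D' : Diagram n) {X P : Type} (K : Wiring X P (Fin n) (Fin 4 ⊕ Fin 4))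
      (Q : Wiring (Fin 2) Empty Empty (Fin 4)) (Q' : Wiring Empty Empty Empty (Fin 4))
      (r : Fin 4) :
      HasArcs Q [(.crossing 0 (0 + r), .slot 0), (.crossing 0 (1 + r), .slot 1),
        (.crossing 0 (2 + r), .crossing 1 (0 + r)), (.crossing 0 (3 + r), .crossing 1 (3 + r)),
        (.crossing 1 (1 + r), .slot 2), (.crossing 1 (2 + r), .slot 3)] →
      HasArcs Q' [(.slot 0, .slot 3), (.slot 1, .slot 2)] →
      Iso (Equiv.sumEmpty (Fin n) Empty) (glue K Q) D.wiring →
      Iso (Equiv.sumEmpty (Fin n) Empty) (glue K Q') D'.wiring →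
      Move D D'
  /-- Type III: a strand is moved over (or under) a crossing (the crossing `2`). -/
  | typeIII (D D' : Diagram n) {X P : Type} (K : Wiring X P (Fin n) (Fin 4 ⊕ Fin 6))
      (Q Q' : Wiring (Fin 3) Empty Empty (Fin 6)) (r s : Fin 4) :
      PassesNorth Q r 0 1 (fun k => .crossing 2 (k + s)) →
      PassesSouth Q' r 0 1 (fun k => .crossing 2 (k + s)) →
      Iso (Equiv.sumEmpty (Fin n) Empty) (glue K Q) D.wiring →
      Iso (Equiv.sumEmpty (Fin n) Empty) (glue K Q') D'.wiring →
      Move D D'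
  /-- Type IV: a strand is moved over (or under) a hole. -/
  | typeIV (D D' : Diagram n) {X P H : Type} (K : Wiring X P H (Fin 4 ⊕ Fin 6))
      (Q Q' : Wiring (Fin 2) Empty Unit (Fin 6)) (ε : H ⊕ Unit ≃ Fin n) (r s : Fin 4) :
      PassesNorth Q r 0 1 (fun k => .hole () (k + s)) →
      PassesSouth Q' r 0 1 (fun k => .hole () (k + s)) →
      Iso ε (glue K Q) D.wiring →
      Iso ε (glue K Q') D'.wiring →
      Move D D'

/-- Two diagrams are isotopic if they are related by a finite sequence of planar isotopies, tangle
Reidemeister moves and their inverses. -/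
def Isotopic {n : ℕ} : Diagram n → Diagram n → Prop := Relation.EqvGen Move

end PuncturedTangle

namespace PuncturedTangle

/-! ### Connectivity of resolved diagrams -/

/-! Since `A ^ 2 = i`, the loop value `-A ^ 2 - A⁻¹ ^ 2` vanishes, so the bracket of a closure is
the weighted number of states with exactly one circle. Filling a hole and closing up outside are
themselves smoothings of four-valent vertices. All entries of the matrix are therefore state sums
over one and the same map, whose vertices are the crossings, the holes and the outer boundary
(`Diagram.bracket_closure`).

Integrality is a parity argument. A planar map with vertices of even degree has a checkerboard
colouring; here it follows from Euler's formula by a dimension count over `ZMod 2`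
(`exists_coloring`). Running along the circles of a smoothing permutes the black darts, and altering
the smoothing at one vertex composes this permutation with a transposition. If there is a single
circle, the permutation is a full cycle, of known sign, so two smoothings with a single circle
differ at an even number of vertices (`IsColoring.prod_eq_one_of_monocyclic`). Each alteration
multiplies the normalized term by `±i`: at a crossing through `A ^ (±2)`, at a hole and outside
through the factors `(-i) ^ t` and `i ^ j`. Hence all nonzero terms of all entries agree up to sign,
and one eighth root of unity turns every term into `±1`. Two integral multiples of the same matrix
differ by a rational factor with eighth power `1`, hence by a sign (`Diagram.mem_invariantSet_iff`).

For invariance, a diagram is cut into an outer and an inner piece. The inner piece enters the state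
sum only through the weighted connections that its states produce between the slots
(`stateSum_glue`), so each move becomes a finite check. Moves II, III and IV preserve these sums and
move I multiplies them by `A` or `A⁻¹`; the factor is common to all entries and is absorbed by the
eighth roots of unity. -/

theorem eqvGen_map {V W : Type*} {r : V → V → Prop} {q : W → W → Prop} (f : V → W)
    (h : ∀ a b, r a b → Relation.EqvGen q (f a) (f b)) {a b : V} (hab : Relation.EqvGen r a b) :
    Relation.EqvGen q (f a) (f b) := by
  induction hab with
  | rel a b hab => exact h a b hab
  | refl a => exact .refl _
  | symm a b _ ih => exact ih.symm
  | trans a b c _ _ ih ih' => exact ih.trans _ _ _ ih'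

theorem eqvGen_iff_of_forall {V : Type*} {r : V → V → Prop} {p : V → Prop}
    (h : ∀ a b, r a b → (p a ↔ p b)) {a b : V} (hab : Relation.EqvGen r a b) : p a ↔ p b := by
  induction hab with
  | rel a b hab => exact h a b hab
  | refl a => exact .rfl
  | symm a b _ ih => exact ih.symm
  | trans a b c _ _ ih ih' => exact ih.trans ih'

/-- The relation `r` generates a single class. -/
def Linked {V : Type*} (r : V → V → Prop) : Prop := ∀ a b, Relation.EqvGen r a b

/-- The map need be neither injective nor surjective: it has only to meet every class. This permits
collapsing marked points or whole inner pieces. -/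
theorem Linked.of_map {V W : Type*} {r : V → V → Prop} {q : W → W → Prop} (hr : Linked r)
    (f : V → W) (h : ∀ a b, r a b → Relation.EqvGen q (f a) (f b))
    (hf : ∀ w, ∃ v, Relation.EqvGen q w (f v)) : Linked q := fun a b => by
  obtain ⟨v, hv⟩ := hf a
  obtain ⟨v', hv'⟩ := hf b
  exact (hv.trans _ _ _ (eqvGen_map f h (hr v v'))).trans _ _ _ hv'.symm

theorem linked_iff_of_equiv {V W : Type*} {r : V → V → Prop} {q : W → W → Prop} (f : V ≃ W)
    (h : ∀ a b, r a b ↔ q (f a) (f b)) : Linked r ↔ Linked q := by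
  refine ⟨fun hr => hr.of_map f (fun a b hab => .rel _ _ ((h a b).1 hab))
      fun w => ⟨f.symm w, by simpa using .refl _⟩,
    fun hq => hq.of_map f.symm (fun a b hab => .rel _ _ ((h _ _).2 (by simpa using hab)))
      fun v => ⟨f v, by simpa using .refl _⟩⟩

theorem linked_iff_card_quot_eq_one {V : Type*} [Finite V] [Nonempty V] {r : V → V → Prop} :
    Linked r ↔ Nat.card (Quot r) = 1 := by
  rw [Nat.card_eq_one_iff_unique]
  constructor
  · intro h
    refine ⟨⟨fun a b => ?_⟩, ⟨Quot.mk _ (Classical.arbitrary V)⟩⟩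
    induction a using Quot.ind
    induction b using Quot.ind
    exact Quot.eqvGen_sound (h _ _)
  · rintro ⟨h, _⟩ a b
    exact Quot.eqvGen_exact (Subsingleton.elim _ _)

/-! ### Smoothings -/

/-- The two smoothings of a four-valent vertex: `true` joins `0` with `3` and `1` with `2`, `false`
joins `0` with `1` and `2` with `3`. -/
def smooth (b : Bool) (k : Fin 4) : Fin 4 := if b then ![3, 2, 1, 0] k else ![1, 0, 3, 2] k

theorem smooth_add_two : ∀ b k, smooth b (k + 2) = smooth b k + 2 := by decide

theorem smooth_smooth : ∀ b k, smooth b (smooth b k) = k := by decide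

/-- A quarter turn exchanges the two smoothings. The shifts in the moves can thus be removed at the
cost of flipping states. -/
theorem smooth_add : ∀ (b : Bool) (k r : Fin 4),
    smooth b (k + r) = smooth (b ^^ decide (r.val % 2 = 1)) k + r := by decide

/-- The reconnection of the darts after smoothing the crossings by `σ`, the holes by `τ` and
joining the slots by `c`. -/
def resolve {X P H B : Type} (σ : X → Bool) (τ : H → Bool) (c : B → B) :
    Dart X P H B → Dart X P H B
  | .crossing x k => .crossing x (smooth (σ x) k)
  | .point p k => .point p (k + 1)
  | .hole h k => .hole h (smooth (τ h) k)
  | .slot b => .slot (c b)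

/-- Two darts are neighbours on a circle of the resolved diagram. -/
def Adjacent {X P H B : Type} (w : Wiring X P H B) (σ : X → Bool) (τ : H → Bool) (c : B → B)
    (d d' : Dart X P H B) : Prop := d' = w.e d ∨ d' = resolve σ τ c d

/-- The resolved diagram is a single circle. -/
def Monocyclic {X P H B : Type} (w : Wiring X P H B) (σ : X → Bool) (τ : H → Bool) (c : B → B) :
    Prop := Linked (Adjacent w σ τ c)

/-- The weight of a splitting. -/
noncomputable def weight (b : Bool) : ℂ := if b then A else A⁻¹

theorem A_ne_zero : A ≠ 0 := Complex.exp_ne_zero _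

theorem A_sq : A ^ 2 = Complex.I := by
  rw [A, ← Complex.exp_nat_mul]
  refine Eq.trans (congrArg Complex.exp ?_) Complex.exp_pi_div_two_mul_I
  push_cast
  ring

theorem A_inv_sq : (A⁻¹) ^ 2 = -Complex.I := by rw [inv_pow, A_sq, Complex.inv_I]

theorem A_pow_eight : A ^ 8 = 1 := by
  rw [show A ^ 8 = (A ^ 2) ^ 4 by ring, A_sq, Complex.I_pow_four]

open Classical in
/-- The sum of the weights of all monocyclic states. -/
noncomputable def stateSum {X P H B : Type} [Fintype X] (w : Wiring X P H B) (τ : H → Bool)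
    (c : B → B) : ℂ :=
  ∑ σ : X → Bool, (∏ x, weight (σ x)) * if Monocyclic w σ τ c then 1 else 0

-- Reconciles the classical decidable equality inside `stateSum` with a given instance.
open Classical in
theorem stateSum_eq_sum {X P H B : Type} [Fintype X] [DecidableEq X] (w : Wiring X P H B)
    (τ : H → Bool) (c : B → B) : stateSum w τ c =
      ∑ σ : X → Bool, (∏ x, weight (σ x)) * if Monocyclic w σ τ c then 1 else 0 :=
  Finset.sum_congr (by congr!) fun _ _ => rfl

/-- The darts of a diagram as a sum of simpler types. -/
def dartEquiv (X P H B : Type) :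
    Dart X P H B ≃ (X × Fin 4) ⊕ (P × Fin 2) ⊕ (H × Fin 4) ⊕ B where
  toFun
    | .crossing x k => .inl (x, k)
    | .point p k => .inr (.inl (p, k))
    | .hole h k => .inr (.inr (.inl (h, k)))
    | .slot b => .inr (.inr (.inr b))
  invFun
    | .inl (x, k) => .crossing x k
    | .inr (.inl (p, k)) => .point p k
    | .inr (.inr (.inl (h, k))) => .hole h k
    | .inr (.inr (.inr b)) => .slot b
  left_inv d := by cases d <;> rfl
  right_inv d := by rcases d with _ | _ | _ | _ <;> rfl

instance {X P H B : Type} [Finite X] [Finite P] [Finite H] [Finite B] : Finite (Dart X P H B) :=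
  Finite.of_equiv _ (dartEquiv X P H B).symm

theorem fundamentalTangle_symm_smooth : ∀ (a : Fin 2) (k : Fin 4),
    fundamentalTangle a (smooth (decide (a = 1)) k) =
      ((fundamentalTangle a k).1, (fundamentalTangle a k).2 + 1) := by decide

theorem closingArcs_smooth : ∀ (j : Fin 2) (k : Fin 4),
    closingArcs j (smooth (decide (j = 0)) k) =
      ((closingArcs j k).1, (closingArcs j k).2 + 1) := by decide

/-- The smoothing of the holes that corresponds to a filling. -/
def fill {n : ℕ} (α : Fin n → Fin 2) (h : Fin n) : Bool := decide (α h = 1)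

/-- The smoothing of the outer boundary that corresponds to a closure. -/
def outer (j : Fin 2) : Fin 4 → Fin 4 := smooth (decide (j = 0))

/-- An inserted arc is a marked point whose two darts are exchanged by `splice`, just as a smoothing
exchanges the legs that it joins. Fillings and closures thereby become smoothings of the holes and
of the outer boundary. -/
theorem closureDarts_resolve {X P : Type} {n : ℕ} (j : Fin 2) (α : Fin n → Fin 2) (σ : X → Bool)
    (d : Dart X P (Fin n) (Fin 4)) :
    closureDarts j α (resolve σ (fill α) (outer j) d) = splice σ (closureDarts j α d) := by
  rcases d with _ | _ | ⟨h, k⟩ | b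
  · rfl
  · rfl
  · have := fundamentalTangle_symm_smooth (α h) k
    simp [closureDarts, resolve, splice, fill, this]
  · have := closingArcs_smooth j b
    simp [closureDarts, resolve, splice, outer, this]

theorem Diagram.monocyclic_iff {n : ℕ} (T : Diagram n) (j : Fin 2) (α : Fin n → Fin 2)
    (σ : T.X → Bool) :
    Monocyclic T.wiring σ (fill α) (outer j) ↔ circles (T.closure j α) σ = 1 := by
  have : Nonempty (Dart T.X (T.P ⊕ (Fin n × Fin 2) ⊕ Fin 2) Empty Empty) :=
    ⟨.point (.inr (.inr 0)) 0⟩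
  rw [circles, ← linked_iff_card_quot_eq_one, Monocyclic]
  refine linked_iff_of_equiv (closureDarts j α) fun a b => ?_
  simp only [Adjacent, ← closureDarts_resolve, Diagram.closure, Pairing.map,
    Equiv.symm_apply_apply, EmbeddingLike.apply_eq_iff_eq]

theorem prod_weight {X : Type} [Fintype X] (σ : X → Bool) :
    ∏ x, weight (σ x) = A ^ (Finset.univ.filter fun x => σ x = true).card *
      (A⁻¹) ^ (Finset.univ.filter fun x => σ x = false).card := by
  simp [weight, Finset.prod_ite, Finset.prod_const]

theorem Diagram.bracket_closure {n : ℕ} (T : Diagram n) (j : Fin 2) (α : Fin n → Fin 2) :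
    bracket (T.closure j α) = stateSum T.wiring (fill α) (outer j) := by
  rw [bracket, stateSum_eq_sum]
  have hδ : -A ^ 2 - (A⁻¹) ^ 2 = 0 := by rw [A_inv_sq, A_sq]; ring
  refine Finset.sum_congr rfl fun σ _ => ?_
  rw [prod_weight, hδ]
  simp only [T.monocyclic_iff]
  congr 1
  -- The exponent is a truncated difference, so zero circles would also give `0 ^ 0 = 1`; the
  -- closing arcs exclude this.
  have hpos : 0 < circles (T.closure j α) σ := by
    have : Nonempty (Quot fun d d' => d' = (T.closure j α).e d ∨ d' = splice σ d) :=
      ⟨Quot.mk _ (.point (.inr (.inr 0)) 0)⟩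
    exact Nat.card_pos
  rcases eq_or_ne (circles (T.closure j α) σ) 1 with h | h
  · simp [h]
  · rw [if_neg h, zero_pow (by omega)]

/-! ### Renaming, subdivision and gluing -/

theorem Respects.exists_crossingEquiv {X P H X' P' H' B : Type} {h : H → H'}
    {φ : Dart X P H B → Dart X' P' H' B} (hφ : Respects h φ) (hinj : Function.Injective φ)
    (hsurj : ∀ x' k, ∃ d, φ d = .crossing x' k) :
    ∃ ψ : X ≃ X', ∀ x, (∀ k, φ (.crossing x k) = .crossing (ψ x) k) ∨
      (∀ k, φ (.crossing x k) = .crossing (ψ x) (k + 2)) := by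
  choose ψ hψ using hφ.crossing
  have hex : ∀ x, ∃ k, φ (.crossing x k) = .crossing (ψ x) 0 := fun x =>
    (hψ x).elim (fun h => ⟨0, h 0⟩) fun h => ⟨2, h 2⟩
  refine ⟨Equiv.ofBijective ψ ⟨fun x y hxy => ?_, fun x' => ?_⟩, hψ⟩
  · obtain ⟨k, hk⟩ := hex x
    obtain ⟨l, hl⟩ := hex y
    have := hinj (hk.trans ((congrArg (Dart.crossing · 0) hxy).trans hl.symm))
    injection this
  · obtain ⟨d, hd⟩ := hsurj x' 0
    rcases d with ⟨x, k⟩ | ⟨p, k⟩ | ⟨i, k⟩ | b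
    · refine ⟨x, ?_⟩
      rcases hψ x with h | h <;> rw [h k] at hd <;> injection hd
    · obtain ⟨p', h | h⟩ := hφ.point p <;> rw [h k] at hd <;> cases hd
    · rw [hφ.hole i k] at hd
      cases hd
    · rw [hφ.slot b] at hd
      cases hd

/-- A half turn at a crossing preserves both smoothings, so the ambiguity in `Respects` is harmless.
-/
theorem Respects.map_resolve {X P H X' P' H' B : Type} {h : H → H'}
    {φ : Dart X P H B → Dart X' P' H' B} (hφ : Respects h φ) {ψ : X → X'}
    (hψ : ∀ x, (∀ k, φ (.crossing x k) = .crossing (ψ x) k) ∨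
      (∀ k, φ (.crossing x k) = .crossing (ψ x) (k + 2)))
    (σ : X' → Bool) (τ : H' → Bool) (c : B → B) (d : Dart X P H B) :
    φ (resolve (σ ∘ ψ) (τ ∘ h) c d) = resolve σ τ c (φ d) := by
  rcases d with ⟨x, k⟩ | ⟨p, k⟩ | ⟨i, k⟩ | b
  · rcases hψ x with h | h <;> simp [resolve, h, smooth_add_two]
  · obtain ⟨p', h | h⟩ := hφ.point p <;> simp [resolve, h]
  · simp [resolve, hφ.hole]
  · simp [resolve, hφ.slot]

theorem stateSum_congr {X P H B X' P' H' B' : Type} [Fintype X] [Fintype X'] {w : Wiring X P H B}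
    {w' : Wiring X' P' H' B'} {τ : H → Bool} {τ' : H' → Bool} {c : B → B} {c' : B' → B'}
    (ψ : X ≃ X') (h : ∀ σ : X' → Bool, Monocyclic w (σ ∘ ψ) τ c ↔ Monocyclic w' σ τ' c') :
    stateSum w τ c = stateSum w' τ' c' := by
  classical
  refine Fintype.sum_equiv (ψ.arrowCongr (Equiv.refl Bool)) _ _ fun σ => ?_
  have hσ : ((ψ.arrowCongr (Equiv.refl Bool)) σ) ∘ ψ = σ := by ext; simp
  rw [← h, hσ]
  congr 1
  exact Fintype.prod_equiv ψ _ _ fun x => by simp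

theorem Iso.exists_crossingEquiv {X P H X' P' H' B : Type} {h : H ≃ H'} {w : Wiring X P H B}
    {w' : Wiring X' P' H' B} (hw : Iso h w w') : Nonempty (X ≃ X') := by
  obtain ⟨φ, hφ, -⟩ := hw
  obtain ⟨ψ, -⟩ := hφ.exists_crossingEquiv φ.injective fun x' k => φ.surjective _
  exact ⟨ψ⟩

theorem Iso.stateSum_eq {X P H X' P' H' B : Type} [Fintype X] [Fintype X'] {h : H ≃ H'}
    {w : Wiring X P H B} {w' : Wiring X' P' H' B} (hw : Iso h w w') (τ : H' → Bool) (c : B → B) :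
    stateSum w (τ ∘ h) c = stateSum w' τ c := by
  obtain ⟨φ, hφ, he⟩ := hw
  obtain ⟨ψ, hψ⟩ := hφ.exists_crossingEquiv φ.injective fun x' k => φ.surjective _
  refine stateSum_congr ψ fun σ => linked_iff_of_equiv φ fun a b => ?_
  simp only [Adjacent, ← he, ← hφ.map_resolve hψ, EmbeddingLike.apply_eq_iff_eq]

theorem Subdivides.stateSum_eq {X P H X' P' B : Type} [Fintype X] [Fintype X']
    {w : Wiring X P H B} {w' : Wiring X' P' H B} (hw : Subdivides w w') (τ : H → Bool)
    (c : B → B) : stateSum w τ c = stateSum w' τ c := by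
  obtain ⟨φ, p, d₀, hinj, hφ, hrange, hp₀, hp₁, he⟩ := hw
  obtain ⟨ψ, hψ⟩ := hφ.exists_crossingEquiv hinj fun x' k => (hrange _).2 fun _ h => by cases h
  refine stateSum_congr ψ fun σ => ?_
  have hres := hφ.map_resolve hψ σ τ c
  rw [Function.comp_id] at hres
  have hp₀' : w'.e (φ d₀) = .point p 0 := by rw [← hp₀, w'.e_e]
  have hp₁' : w'.e (φ (w.e d₀)) = .point p 1 := by rw [← hp₁, w'.e_e]
  have hcases : ∀ y, (∃ d, φ d = y) ∨ ∃ k, y = .point p k := fun y => by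
    by_cases h : ∃ k, y = .point p k
    · exact .inr h
    · exact .inl ((hrange y).2 (by simpa using h))
  have hnot : ∀ d k, φ d ≠ .point p k := fun d => (hrange _).1 ⟨d, rfl⟩
  constructor
  · intro hr
    refine hr.of_map φ ?_ fun y => ?_
    · rintro a b (rfl | rfl)
      · have hpath : Relation.EqvGen (Adjacent w' σ τ c) (φ d₀) (φ (w.e d₀)) := by
          refine .trans _ (.point p 0) _ (.rel _ _ (.inl hp₀'.symm)) ?_
          refine .trans _ (.point p 1) _ (.rel _ _ (.inr (by simp [resolve]))) ?_
          exact .rel _ _ (.inl hp₁.symm)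
        by_cases h₀ : a = d₀
        · rw [h₀]; exact hpath
        by_cases h₁ : a = w.e d₀
        · rw [h₁, w.e_e]; exact hpath.symm
        exact .rel _ _ (.inl (he a h₀ h₁).symm)
      · exact .rel _ _ (.inr (hres a))
    · rcases hcases y with ⟨d, rfl⟩ | ⟨k, rfl⟩
      · exact ⟨d, .refl _⟩
      · obtain rfl | rfl : k = 0 ∨ k = 1 := by omega
        · exact ⟨d₀, .rel _ _ (.inl hp₀.symm)⟩
        · exact ⟨w.e d₀, .rel _ _ (.inl hp₁.symm)⟩
  · intro hr
    -- A left inverse of `φ` that sends the two darts of the new point to the ends of the arc it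
    -- subdivides.
    have hex : ∀ y, ∃ d, (∀ d', φ d' = y → d = d') ∧ (y = .point p 0 → d = d₀) ∧
        (y = .point p 1 → d = w.e d₀) := fun y => by
      rcases hcases y with ⟨d, rfl⟩ | ⟨k, rfl⟩
      · exact ⟨d, fun d' h => hinj h.symm, fun h => (hnot _ _ h).elim,
          fun h => (hnot _ _ h).elim⟩
      · obtain rfl | rfl : k = 0 ∨ k = 1 := by omega
        · exact ⟨d₀, fun d' h => (hnot _ _ h).elim, fun _ => rfl, fun h => by simp at h⟩
        · exact ⟨w.e d₀, fun d' h => (hnot _ _ h).elim, fun h => by simp at h, fun _ => rfl⟩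
    choose f hf using hex
    have hfφ : ∀ d, f (φ d) = d := fun d => (hf _).1 d rfl
    have hf₀ : f (.point p 0) = d₀ := (hf _).2.1 rfl
    have hf₁ : f (.point p 1) = w.e d₀ := (hf _).2.2 rfl
    refine hr.of_map f ?_ fun d => ⟨φ d, by rw [hfφ]; exact .refl _⟩
    have hpath : Relation.EqvGen (Adjacent w (σ ∘ ψ) τ c) d₀ (w.e d₀) := .rel _ _ (.inl rfl)
    rintro a b (rfl | rfl)
    · rcases hcases a with ⟨d, rfl⟩ | ⟨k, rfl⟩
      · by_cases h₀ : d = d₀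
        · rw [h₀, hp₀', hfφ, hf₀]; exact .refl _
        by_cases h₁ : d = w.e d₀
        · rw [h₁, hp₁', hfφ, hf₁]; exact .refl _
        rw [he d h₀ h₁, hfφ, hfφ]
        exact .rel _ _ (.inl rfl)
      · obtain rfl | rfl : k = 0 ∨ k = 1 := by omega
        · rw [hp₀, hf₀, hfφ]; exact .refl _
        · rw [hp₁, hf₁, hfφ]; exact .refl _
    · rcases hcases a with ⟨d, rfl⟩ | ⟨k, rfl⟩
      · rw [← hres, hfφ, hfφ]
        exact .rel _ _ (.inr rfl)
      · obtain rfl | rfl : k = 0 ∨ k = 1 := by omega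
        · simpa [resolve, hf₀, hf₁] using hpath
        · simpa [resolve, hf₀, hf₁] using hpath.symm

/-- Two slots lie on the same strand of the resolved inner piece. -/
def SlotsJoined {X P H B : Type} (Q : Wiring X P H B) (σ : X → Bool) (τ : H → Bool) (b b' : B) :
    Prop := Relation.EqvGen (Adjacent Q σ τ id) (.slot b) (.slot b')

/-- The resolved inner piece has no closed circle. -/
def LoopFree {X P H B : Type} (Q : Wiring X P H B) (σ : X → Bool) (τ : H → Bool) : Prop :=
  ∀ d, ∃ b, Relation.EqvGen (Adjacent Q σ τ id) d (.slot b)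

/-- Adjacency in the resolved outer piece, whose inner slots are joined by the relation `E`. -/
def OuterAdjacent {X P H B₀ B : Type} (K : Wiring X P H (B₀ ⊕ B)) (σ : X → Bool) (τ : H → Bool)
    (c : B₀ → B₀) (E : B → B → Prop) (d d' : Dart X P H (B₀ ⊕ B)) : Prop :=
  Adjacent K σ τ (Sum.map c id) d d' ∨
    ∃ b b', E b b' ∧ d = .slot (.inr b) ∧ d' = .slot (.inr b')

section Glue

variable {X P H X' P' H' B₀ B : Type}

/-- Adjacency in a composed diagram, on the darts of the two pieces. -/
def GlueAdjacent (K : Wiring X P H (B₀ ⊕ B)) (Q : Wiring X' P' H' B) (σ : X ⊕ X' → Bool)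
    (τ : H ⊕ H' → Bool) (c : B₀ → B₀) (d d' : Dart X P H (B₀ ⊕ B) ⊕ Dart X' P' H' B) : Prop :=
  Adjacent (glue K Q) σ τ c (glueDarts X P H X' P' H' B₀ B d) (glueDarts X P H X' P' H' B₀ B d')

theorem glue_e_glueDarts (K : Wiring X P H (B₀ ⊕ B)) (Q : Wiring X' P' H' B)
    (d : Dart X P H (B₀ ⊕ B) ⊕ Dart X' P' H' B) :
    (glue K Q).e (glueDarts X P H X' P' H' B₀ B d) =
      glueDarts X P H X' P' H' B₀ B (Sum.map K.e Q.e d) := by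
  simp [glue, Pairing.map, Pairing.sum]

theorem resolve_glueDarts (σ : X ⊕ X' → Bool) (τ : H ⊕ H' → Bool) (c : B₀ → B₀)
    (d : Dart X P H (B₀ ⊕ B) ⊕ Dart X' P' H' B) :
    resolve σ τ c (glueDarts X P H X' P' H' B₀ B d) = glueDarts X P H X' P' H' B₀ B
      (match d with
      | .inl (.slot (.inr b)) => .inr (.slot b)
      | .inr (.slot b) => .inl (.slot (.inr b))
      | .inl d => .inl (resolve (σ ∘ .inl) (τ ∘ .inl) (Sum.map c id) d)
      | .inr d => .inr (resolve (σ ∘ .inr) (τ ∘ .inr) id d)) := by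
  rcases d with (_ | _ | _ | (_ | _)) | (_ | _ | _ | _) <;> rfl

theorem glueAdjacent_iff (K : Wiring X P H (B₀ ⊕ B)) (Q : Wiring X' P' H' B) (σ : X ⊕ X' → Bool)
    (τ : H ⊕ H' → Bool) (c : B₀ → B₀) (d d' : Dart X P H (B₀ ⊕ B) ⊕ Dart X' P' H' B) :
    GlueAdjacent K Q σ τ c d d' ↔ d' = Sum.map K.e Q.e d ∨ d' =
      (match d with
      | .inl (.slot (.inr b)) => .inr (.slot b)
      | .inr (.slot b) => .inl (.slot (.inr b))
      | .inl d => .inl (resolve (σ ∘ .inl) (τ ∘ .inl) (Sum.map c id) d)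
      | .inr d => .inr (resolve (σ ∘ .inr) (τ ∘ .inr) id d)) := by
  rw [GlueAdjacent, Adjacent, glue_e_glueDarts, resolve_glueDarts]
  simp only [EmbeddingLike.apply_eq_iff_eq]

/-- A circle inside the inner piece could never be connected to a slot. If there is none, every
inner strand may be contracted to a connection between slots. -/
theorem monocyclic_glue [Nonempty B] (K : Wiring X P H (B₀ ⊕ B)) (Q : Wiring X' P' H' B)
    (σ : X ⊕ X' → Bool) (τ : H ⊕ H' → Bool) (c : B₀ → B₀) :
    Monocyclic (glue K Q) σ τ c ↔ LoopFree Q (σ ∘ .inr) (τ ∘ .inr) ∧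
      Linked (OuterAdjacent K (σ ∘ .inl) (τ ∘ .inl) c
        (SlotsJoined Q (σ ∘ .inr) (τ ∘ .inr))) := by
  have key : Monocyclic (glue K Q) σ τ c ↔ Linked (GlueAdjacent K Q σ τ c) :=
    (linked_iff_of_equiv (glueDarts X P H X' P' H' B₀ B) fun _ _ => .rfl).symm
  rw [key]
  set RQ := Adjacent Q (σ ∘ .inr) (τ ∘ .inr) id with hRQ
  have cross : ∀ b, Relation.EqvGen (GlueAdjacent K Q σ τ c) (.inr (.slot b))
      (.inl (.slot (.inr b))) := fun b => .rel _ _ ((glueAdjacent_iff ..).2 (.inr rfl))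
  have inner : ∀ a b, RQ a b → Relation.EqvGen (GlueAdjacent K Q σ τ c) (.inr a) (.inr b) := by
    rintro a b (rfl | rfl)
    · exact .rel _ _ ((glueAdjacent_iff ..).2 (.inl rfl))
    · rcases a with _ | _ | _ | _
      case slot => exact .refl _
      all_goals exact .rel _ _ ((glueAdjacent_iff ..).2 (.inr rfl))
  constructor
  · intro hl
    have hlf : LoopFree Q (σ ∘ .inr) (τ ∘ .inr) := by
      -- A property constant along circles: it holds on the outer piece, and for an inner dart it
      -- says that its strand reaches a slot.
      let p : Dart X P H (B₀ ⊕ B) ⊕ Dart X' P' H' B → Prop :=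
        Sum.elim (fun _ => True) fun d => ∃ b, Relation.EqvGen RQ d (.slot b)
      have hp : ∀ a b, GlueAdjacent K Q σ τ c a b → (p a ↔ p b) := by
        intro a b hab
        have hstep : ∀ d d', RQ d d' → ((∃ b, Relation.EqvGen RQ d (.slot b)) ↔
            ∃ b, Relation.EqvGen RQ d' (.slot b)) := fun d d' h =>
          exists_congr fun b => ⟨(Relation.EqvGen.rel _ _ h).symm.trans _ _ _,
            (Relation.EqvGen.rel _ _ h).trans _ _ _⟩
        rcases (glueAdjacent_iff ..).1 hab with rfl | rfl
        · rcases a with a | a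
          · exact .rfl
          · exact hstep _ _ (.inl rfl)
        · rcases a with (_ | _ | _ | (_ | _)) | (a | a | a | b)
          case inr.slot => exact ⟨fun _ => trivial, fun _ => ⟨b, .refl _⟩⟩
          case inl.slot.inr b => exact ⟨fun _ => ⟨b, .refl _⟩, fun _ => trivial⟩
          case inr.crossing => exact hstep _ _ (.inr rfl)
          case inr.point => exact hstep _ _ (.inr rfl)
          case inr.hole => exact hstep _ _ (.inr rfl)
          all_goals exact .rfl
      intro d
      obtain ⟨b₀⟩ := ‹Nonempty B›
      exact (eqvGen_iff_of_forall hp (hl (.inl (.slot (.inr b₀))) (.inr d))).1 trivial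
    refine ⟨hlf, ?_⟩
    -- Contraction of the inner piece: each dart moves to a slot on its own strand.
    choose β hβ using hlf
    refine hl.of_map (Sum.elim id fun d => .slot (.inr (β d))) ?_ fun d => ⟨.inl d, .refl _⟩
    have hstep : ∀ d d', RQ d d' → Relation.EqvGen (OuterAdjacent K (σ ∘ .inl) (τ ∘ .inl) c
        (SlotsJoined Q (σ ∘ .inr) (τ ∘ .inr))) (.slot (.inr (β d))) (.slot (.inr (β d'))) :=
      fun d d' h => .rel _ _ (.inr ⟨_, _,
        ((hβ d).symm.trans _ _ _ (.rel _ _ h)).trans _ _ _ (hβ d'), rfl, rfl⟩)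
    have hslot : ∀ b, Relation.EqvGen (OuterAdjacent K (σ ∘ .inl) (τ ∘ .inl) c
        (SlotsJoined Q (σ ∘ .inr) (τ ∘ .inr))) (.slot (.inr b)) (.slot (.inr (β (.slot b)))) :=
      fun b => .rel _ _ (.inr ⟨_, _, hβ _, rfl, rfl⟩)
    intro a b hab
    rcases (glueAdjacent_iff ..).1 hab with rfl | rfl
    · rcases a with a | a
      · exact .rel _ _ (.inl (.inl rfl))
      · exact hstep _ _ (.inl rfl)
    · rcases a with (_ | _ | _ | (_ | _)) | (a | a | a | b)
      case inr.slot => exact (hslot b).symm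
      case inl.slot.inr b => exact hslot b
      case inr.crossing => exact hstep _ _ (.inr rfl)
      case inr.point => exact hstep _ _ (.inr rfl)
      case inr.hole => exact hstep _ _ (.inr rfl)
      all_goals exact .rel _ _ (.inl (.inr rfl))
  · rintro ⟨hlf, hl⟩
    refine hl.of_map .inl ?_ fun d => ?_
    · rintro a b ((rfl | rfl) | ⟨b, b', h, rfl, rfl⟩)
      · exact .rel _ _ ((glueAdjacent_iff ..).2 (.inl rfl))
      · rcases a with _ | _ | _ | (_ | _)
        case slot.inr => exact .refl _
        all_goals exact .rel _ _ ((glueAdjacent_iff ..).2 (.inr rfl))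
      · exact ((cross b).symm.trans _ _ _ (eqvGen_map Sum.inr inner h)).trans _ _ _ (cross b')
    · rcases d with d | d
      · exact ⟨d, .refl _⟩
      · obtain ⟨b, hb⟩ := hlf d
        exact ⟨_, (eqvGen_map Sum.inr inner hb).trans _ _ _ (cross b)⟩

open Classical in
/-- The contribution of an inner piece to the state sum, the outer piece being represented by the
property `C` of the way in which the slots are joined. -/
noncomputable def innerSum [Fintype X'] (Q : Wiring X' P' H' B) (τ : H' → Bool)
    (C : (B → B → Prop) → Prop) : ℂ :=
  ∑ σ : X' → Bool, (∏ x, weight (σ x)) *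
    if LoopFree Q σ τ ∧ C (SlotsJoined Q σ τ) then 1 else 0

-- A state of the composed diagram is a pair of states, and the outer one is felt inside only as a
-- property of the connections. An identity of `innerSum` for all such properties therefore holds in
-- every surrounding diagram.
open Classical in
theorem stateSum_glue [Nonempty B] [Fintype X] [Fintype X'] (K : Wiring X P H (B₀ ⊕ B))
    (Q : Wiring X' P' H' B) (τ : H ⊕ H' → Bool) (c : B₀ → B₀) :
    stateSum (glue K Q) τ c = ∑ σ : X → Bool, (∏ x, weight (σ x)) *
      innerSum Q (τ ∘ .inr) fun E => Linked (OuterAdjacent K σ (τ ∘ .inl) c E) := by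
  rw [stateSum_eq_sum]
  simp only [innerSum, Finset.mul_sum]
  refine (Fintype.sum_equiv (Equiv.sumArrowEquivProdArrow X X' Bool) _
    (fun p => (∏ x, weight (p.1 x)) * ((∏ x, weight (p.2 x)) *
      if LoopFree Q p.2 (τ ∘ .inr) ∧ Linked (OuterAdjacent K p.1 (τ ∘ .inl) c
        (SlotsJoined Q p.2 (τ ∘ .inr))) then 1 else 0)) fun σ => ?_).trans
    (Fintype.sum_prod_type _)
  simp only [monocyclic_glue, Fintype.prod_sum_type, mul_assoc]
  rfl

end Glue

/-- A local replacement multiplies the state sum by `u`. -/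
theorem stateSum_eq_mul_of_innerSum {n : ℕ} {D D' : Diagram n} {X P H X₁ P₁ X₂ P₂ H₁ B : Type}
    [Nonempty B] [Fintype X₁] [Fintype X₂] {K : Wiring X P H (Fin 4 ⊕ B)}
    {Q : Wiring X₁ P₁ H₁ B} {Q' : Wiring X₂ P₂ H₁ B} {ε : H ⊕ H₁ ≃ Fin n}
    (h : Iso ε (glue K Q) D.wiring) (h' : Iso ε (glue K Q') D'.wiring) {u : ℂ}
    (hu : ∀ τ C, innerSum Q τ C = u * innerSum Q' τ C) (τ : Fin n → Bool) (c : Fin 4 → Fin 4) :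
    stateSum D.wiring τ c = u * stateSum D'.wiring τ c := by
  obtain ⟨ψ⟩ := h.exists_crossingEquiv
  have : Finite (X ⊕ X₁) := .of_equiv _ ψ.symm
  have : Finite X := .of_injective (Sum.inl : X → X ⊕ X₁) Sum.inl_injective
  have := Fintype.ofFinite X
  rw [← h.stateSum_eq, ← h'.stateSum_eq, stateSum_glue, stateSum_glue, Finset.mul_sum]
  refine Finset.sum_congr rfl fun σ _ => ?_
  rw [hu, mul_left_comm]

/-! ### Finite models of small pieces -/

/-- The darts of a piece with `m` four-valent vertices and `l` slots. -/
abbrev Model (m l : ℕ) : Type := (Fin m × Fin 4) ⊕ Fin l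

namespace Model

variable {m l : ℕ}

/-- The map of darts with given values at the vertices and at the slots. -/
def ofTables (v : Fin m → Fin 4 → Model m l) (s : Fin l → Model m l) : Model m l → Model m l :=
  Sum.elim (fun q => v q.1 q.2) s

/-- The smoothing of all vertices. -/
def resolve (t : Fin m → Bool) : Model m l → Model m l :=
  Sum.map (fun q => (q.1, smooth (t q.1) q.2)) id

/-- Adjacency in the resolved piece. -/
def Adjacent (e : Model m l → Model m l) (t : Fin m → Bool) (u v : Model m l) : Prop :=
  v = e u ∨ v = resolve t u

/-- The slot that is reached from a dart in at most `n` steps. -/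
def exit (e : Model m l → Model m l) (t : Fin m → Bool) : ℕ → Model m l → Option (Fin l)
  | _, .inr b => some b
  | 0, .inl _ => none
  | n + 1, .inl q => exit e t n (resolve t (e (.inl q)))

/-- The slot `b` is one of the ends of the strand through the dart `u`. -/
def reaches (e : Model m l → Model m l) (t : Fin m → Bool) (u : Model m l) (b : Fin l) : Bool :=
  -- The first two walks leave `u` in opposite directions; the third finds the far end when `u` is
  -- itself a slot. The largest models have twelve darts at vertices.
  exit e t 12 u = some b || exit e t 12 (resolve t u) = some b ||
    exit e t 12 (resolve t (e u)) = some b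

/-- The ends of the strands are the same for adjacent darts. -/
def Consistent (e : Model m l → Model m l) (t : Fin m → Bool) : Prop :=
  ∀ u b, reaches e t (e u) b = reaches e t u b ∧ reaches e t (resolve t u) b = reaches e t u b

instance (e : Model m l → Model m l) (t : Fin m → Bool) : Decidable (Consistent e t) :=
  inferInstanceAs (Decidable (∀ _ _, _ ∧ _))

/-- The connections between the slots in the resolved piece, or `none` if there is a closed
circle. -/
def outcome (e : Model m l → Model m l) (t : Fin m → Bool) : Option (Fin l → Fin l → Bool) :=
  if ∀ u, ∃ b, reaches e t u b = true then some fun b => reaches e t (.inr b) else none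

theorem eqvGen_of_exit {e : Model m l → Model m l} {t : Fin m → Bool} {b : Fin l} :
    ∀ (n : ℕ) (u : Model m l), exit e t n u = some b →
      Relation.EqvGen (Adjacent e t) u (.inr b)
  | n, .inr b', h => by
    have : b' = b := by cases n <;> simpa [exit] using h
    rw [this]
    exact .refl _
  | 0, .inl q, h => by simp [exit] at h
  | n + 1, .inl q, h =>
    ((Relation.EqvGen.rel (.inl q) _ (.inl rfl)).trans _ _ _ (.rel _ _ (.inr rfl))).trans _ _ _
      (eqvGen_of_exit n _ h)

theorem eqvGen_of_reaches {e : Model m l → Model m l} {t : Fin m → Bool} {b : Fin l}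
    {u : Model m l} (h : reaches e t u b = true) : Relation.EqvGen (Adjacent e t) u (.inr b) := by
  simp only [reaches, Bool.or_eq_true, decide_eq_true_eq] at h
  rcases h with (h | h) | h
  · exact eqvGen_of_exit _ _ h
  · exact (Relation.EqvGen.rel _ _ (.inr rfl)).trans _ _ _ (eqvGen_of_exit _ _ h)
  · exact ((Relation.EqvGen.rel _ _ (.inl rfl)).trans _ _ _ (.rel _ _ (.inr rfl))).trans _ _ _
      (eqvGen_of_exit _ _ h)

/-- Walks always give genuine connections. Conversely, a function constant along adjacency cannot
miss one, so the bound on the number of steps needs no separate justification. -/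
theorem Consistent.eqvGen_iff {e : Model m l → Model m l} {t : Fin m → Bool}
    (h : Consistent e t) (u : Model m l) (b : Fin l) :
    Relation.EqvGen (Adjacent e t) u (.inr b) ↔ reaches e t u b = true := by
  refine ⟨fun hu => ?_, eqvGen_of_reaches⟩
  refine (eqvGen_iff_of_forall (p := fun u => reaches e t u b = true) ?_ hu).2 ?_
  · rintro u v (rfl | rfl)
    · rw [(h u b).1]
    · rw [(h u b).2]
  · simp [reaches, exit]

/-- The darts of a piece without marked points, the numbering at the vertex `i` being shifted
by `ρ i`. -/
def darts {X H : Type} (ι : X ⊕ H ≃ Fin m) (ρ : Fin m → Fin 4) :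
    Model m l ≃ Dart X Empty H (Fin l) where
  toFun
    | .inl (i, k) => Sum.elim (fun x => .crossing x (k + ρ i)) (fun h => .hole h (k + ρ i))
        (ι.symm i)
    | .inr b => .slot b
  invFun
    | .crossing x k => .inl (ι (.inl x), k - ρ (ι (.inl x)))
    | .hole h k => .inl (ι (.inr h), k - ρ (ι (.inr h)))
    | .slot b => .inr b
  left_inv u := by
    rcases u with ⟨i, k⟩ | b
    · obtain ⟨x | h, rfl⟩ := ι.surjective i <;> simp
    · rfl
  right_inv d := by rcases d with _ | ⟨⟨⟩⟩ | _ | _ <;> simp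

/-- The smoothings of the vertices of the model. -/
def states {X H : Type} (ι : X ⊕ H ≃ Fin m) (ρ : Fin m → Fin 4) (σ : X → Bool) (τ : H → Bool)
    (i : Fin m) : Bool := Sum.elim σ τ (ι.symm i) ^^ decide ((ρ i).val % 2 = 1)

section

variable {X H : Type} {ι : X ⊕ H ≃ Fin m} {ρ : Fin m → Fin 4} {Q : Wiring X Empty H (Fin l)}
  {e : Model m l → Model m l}

theorem adjacent_darts (he : ∀ u, Q.e (darts ι ρ u) = darts ι ρ (e u)) (σ : X → Bool)
    (τ : H → Bool) (u v : Model m l) : Adjacent e (states ι ρ σ τ) u v ↔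
      PuncturedTangle.Adjacent Q σ τ id (darts ι ρ u) (darts ι ρ v) := by
  have hres : PuncturedTangle.resolve σ τ id (darts ι ρ u) =
      darts ι ρ (resolve (states ι ρ σ τ) u) := by
    rcases u with ⟨i, k⟩ | b
    · obtain ⟨x | h, rfl⟩ := ι.surjective i <;>
        simp [darts, resolve, PuncturedTangle.resolve, states, smooth_add]
    · rfl
  rw [Adjacent, PuncturedTangle.Adjacent, he, hres]
  simp only [EmbeddingLike.apply_eq_iff_eq]

theorem eqvGen_darts (he : ∀ u, Q.e (darts ι ρ u) = darts ι ρ (e u)) (σ : X → Bool)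
    (τ : H → Bool) (h : Consistent e (states ι ρ σ τ)) (u : Model m l) (b : Fin l) :
    Relation.EqvGen (PuncturedTangle.Adjacent Q σ τ id) (darts ι ρ u) (.slot b) ↔
      reaches e (states ι ρ σ τ) u b = true := by
  rw [← h.eqvGen_iff]
  constructor
  · intro hu
    have := eqvGen_map (q := Adjacent e (states ι ρ σ τ)) (darts ι ρ).symm
      (fun a b hab => .rel _ _ ((adjacent_darts he σ τ _ _).2 (by simpa using hab))) hu
    rw [Equiv.symm_apply_apply] at this
    exact this
  · exact eqvGen_map (darts ι ρ) fun a b hab => .rel _ _ ((adjacent_darts he σ τ _ _).1 hab)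

open Classical in
/-- The value of a property on the connections in a resolved piece. -/
noncomputable def value (C : (Fin l → Fin l → Prop) → Prop) :
    Option (Fin l → Fin l → Bool) → ℂ
  | none => 0
  | some f => if C fun b b' => f b b' = true then 1 else 0

theorem innerSum_eq [Fintype X] [DecidableEq X] (he : ∀ u, Q.e (darts ι ρ u) = darts ι ρ (e u))
    (h : ∀ t, Consistent e t) (τ : H → Bool) (C : (Fin l → Fin l → Prop) → Prop) :
    innerSum Q τ C =
      ∑ σ : X → Bool, (∏ x, weight (σ x)) * value C (outcome e (states ι ρ σ τ)) := by
  rw [innerSum]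
  refine Finset.sum_congr (by congr!) fun σ _ => ?_
  congr 1
  have h₁ : SlotsJoined Q σ τ = fun b b' => reaches e (states ι ρ σ τ) (.inr b) b' = true := by
    ext b b'
    exact eqvGen_darts he σ τ (h _) (.inr b) b'
  have h₂ : LoopFree Q σ τ ↔ ∀ u, ∃ b, reaches e (states ι ρ σ τ) u b = true := by
    rw [LoopFree, (darts ι ρ).surjective.forall]
    exact forall_congr' fun u => exists_congr fun b => eqvGen_darts he σ τ (h _) u b
  rw [h₁, h₂, outcome]
  split_ifs with h₃ h₄ h₄
  · simp [value, h₃.2]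
  · exact (h₄ h₃.1).elim
  · rw [value, if_neg fun hC => h₃ ⟨h₄, hC⟩]
  · rfl

theorem e_darts_of_hasArcs {arcs : List (Model m l × Model m l)}
    (hQ : HasArcs Q (arcs.map (Prod.map (darts ι ρ) (darts ι ρ))))
    (he : ∀ u, ∃ q ∈ arcs, q = (u, e u) ∨ q = (e u, u)) (u : Model m l) :
    Q.e (darts ι ρ u) = darts ι ρ (e u) := by
  obtain ⟨_, h, rfl | rfl⟩ := he u
  · exact hQ _ (List.mem_map_of_mem h)
  · have : Q.e (darts ι ρ (e u)) = darts ι ρ u := hQ _ (List.mem_map_of_mem h)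
    rw [← this, Q.e_e]

end

/-! ### Tables of the local pictures in the moves -/

def kink : Model 1 2 → Model 1 2 :=
  ofTables ![![.inl (0, 1), .inl (0, 0), .inr 0, .inr 1]] ![.inl (0, 2), .inl (0, 3)]

def arc : Model 0 2 → Model 0 2 := ofTables ![] ![.inr 1, .inr 0]

def clasp : Model 2 4 → Model 2 4 :=
  ofTables ![![.inr 0, .inr 1, .inl (1, 0), .inl (1, 3)],
      ![.inl (0, 2), .inr 2, .inr 3, .inl (0, 3)]]
    ![.inl (0, 0), .inl (0, 1), .inl (1, 1), .inl (1, 2)]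

def twoArcs : Model 0 4 → Model 0 4 := ofTables ![] ![.inr 3, .inr 2, .inr 1, .inr 0]

def north : Model 3 6 → Model 3 6 :=
  ofTables ![![.inr 0, .inr 1, .inl (1, 0), .inl (2, 0)],
      ![.inl (0, 2), .inr 2, .inr 3, .inl (2, 1)],
      ![.inl (0, 3), .inl (1, 3), .inr 4, .inr 5]]
    ![.inl (0, 0), .inl (0, 1), .inl (1, 1), .inl (1, 2), .inl (2, 2), .inl (2, 3)]

def south : Model 3 6 → Model 3 6 :=
  ofTables ![![.inl (1, 2), .inl (2, 2), .inr 3, .inr 4],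
      ![.inr 0, .inl (2, 3), .inl (0, 0), .inr 5],
      ![.inr 1, .inr 2, .inl (0, 1), .inl (1, 1)]]
    ![.inl (1, 0), .inl (2, 0), .inl (2, 1), .inl (0, 2), .inl (0, 3), .inl (1, 3)]

end Model
/-! ### Invariance of the state sum under the moves -/

open Model

theorem sum_bool_fin_one (f : (Fin 1 → Bool) → ℂ) : ∑ σ, f σ = f ![true] + f ![false] := by
  rw [Fintype.sum_equiv (Equiv.funUnique (Fin 1) Bool) f (fun b => f ![b])
    fun σ => congrArg f (by ext i; fin_cases i; rfl), Fintype.sum_bool]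

theorem sum_bool_fin_two (f : (Fin 2 → Bool) → ℂ) :
    ∑ σ, f σ = ∑ a : Bool, ∑ b : Bool, f ![a, b] := by
  rw [Fintype.sum_equiv (finTwoArrowEquiv Bool) f (fun q => f ![q.1, q.2])
    fun σ => congrArg f (by ext i; fin_cases i <;> rfl), Fintype.sum_prod_type]

theorem sum_bool_fin_three (f : (Fin 3 → Bool) → ℂ) :
    ∑ σ, f σ = ∑ c : Bool, ∑ a : Bool, ∑ b : Bool, f ![a, b, c] := by
  let φ : (Fin 3 → Bool) ≃ Bool × Bool × Bool :=
    { toFun := fun σ => (σ 2, σ 0, σ 1)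
      invFun := fun q => ![q.2.1, q.2.2, q.1]
      left_inv := fun σ => by ext i; fin_cases i <;> rfl
      right_inv := fun q => rfl }
  rw [Fintype.sum_equiv φ f (fun q => f ![q.2.1, q.2.2, q.1])
    fun σ => congrArg f (φ.left_inv σ).symm]
  simp only [Fintype.sum_prod_type]

theorem weight_mul_weight (a : Bool) : weight a * weight (!a) = 1 := by
  cases a <;> simp [weight, A_ne_zero]

theorem weight_sq_add_weight_sq (a : Bool) :
    weight a * weight a + weight (!a) * weight (!a) = 0 := by
  rw [← sq, ← sq]
  cases a <;> simp only [weight, Bool.not_false, Bool.not_true, if_true, if_false,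
    A_inv_sq, A_sq, Bool.false_eq_true] <;> ring

/-- The contribution of two crossings, the state of which may have been flipped by a quarter turn,
if one state contributes a circle and two others cancel. -/
theorem sum_weight_mul_weight_mul (p : Bool) (g : Bool → Bool → ℂ) (h₀ : g false true = 0)
    (h₁ : g true true = g false false) :
    ∑ a : Bool, ∑ b : Bool, weight a * weight b * g (a ^^ p) (b ^^ p) = g true false := by
  have h₂ := weight_mul_weight p
  have h₃ := weight_sq_add_weight_sq p
  cases p
  · simp only [Fintype.sum_bool, Bool.xor_false, h₀, h₁, Bool.not_false] at h₂ h₃ ⊢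
    linear_combination g true false * h₂ + g false false * h₃
  · simp only [Fintype.sum_bool, Bool.xor_true, h₀, h₁, Bool.not_true, Bool.not_false]
      at h₂ h₃ ⊢
    linear_combination g true false * h₂ + g false false * h₃

theorem consistent_arc : ∀ t, Consistent arc t := by decide +kernel
theorem consistent_kink : ∀ t, Consistent kink t := by decide +kernel
theorem consistent_twoArcs : ∀ t, Consistent twoArcs t := by decide +kernel
theorem consistent_clasp : ∀ t, Consistent clasp t := by decide +kernel
theorem consistent_north : ∀ t, Consistent north t := by decide +kernel
theorem consistent_south : ∀ t, Consistent south t := by decide +kernel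

theorem outcome_kink : outcome kink ![false] = none ∧
    ∀ t, outcome kink ![true] = outcome arc t := by decide +kernel

/-- One state splits off a circle, two have equal connections and weights `A ^ 2`, `A⁻¹ ^ 2` that
cancel, and the last one is the untangled picture. -/
theorem outcome_clasp : outcome clasp ![false, true] = none ∧
    outcome clasp ![true, true] = outcome clasp ![false, false] ∧
    ∀ t, outcome clasp ![true, false] = outcome twoArcs t := by decide +kernel

/-- This smoothing joins the two northern legs, so the strand forms a clasp with an arc, as in type
II. -/
theorem outcome_north_false : outcome north ![false, true, false] = none ∧
    outcome north ![true, true, false] = outcome north ![false, false, false] ∧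
    outcome north ![true, false, false] = outcome south ![true, false, false] := by decide +kernel

theorem outcome_south_false : outcome south ![false, true, false] = none ∧
    outcome south ![true, true, false] = outcome south ![false, false, false] := by decide +kernel

/-- This smoothing leaves two vertical strands, along which the horizontal one slides freely. The
states are exchanged because crossing `0` is on the right in `north` and on the left in `south`. -/
theorem outcome_north_true : ∀ a b,
    outcome north ![a, b, true] = outcome south ![b, a, true] := by decide +kernel

/-- A strand may be moved across a smoothed vertex. -/
theorem sum_north_eq_sum_south (C : (Fin 6 → Fin 6 → Prop) → Prop) (p z : Bool) :
    ∑ a : Bool, ∑ b : Bool, weight a * weight b * value C (outcome north ![a ^^ p, b ^^ p, z]) =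
    ∑ a : Bool, ∑ b : Bool, weight a * weight b * value C (outcome south ![a ^^ p, b ^^ p, z]) := by
  cases z
  · rw [sum_weight_mul_weight_mul p fun a b => value C (outcome north ![a, b, false]),
      sum_weight_mul_weight_mul p fun a b => value C (outcome south ![a, b, false]),
      outcome_north_false.2.2]
    · simp only [outcome_south_false.1, value]
    · simp only [outcome_south_false.2]
    · simp only [outcome_north_false.1, value]
    · simp only [outcome_north_false.2.1]
  · rw [Finset.sum_comm]
    simp only [outcome_north_true, mul_comm (weight _) (weight _)]

theorem innerSum_kink {Q : Wiring (Fin 1) Empty Empty (Fin 2)}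
    {Q' : Wiring Empty Empty Empty (Fin 2)} {k : Fin 4}
    (hQ : HasArcs Q [(.crossing 0 k, .crossing 0 (k + 1)), (.crossing 0 (k + 2), .slot 0),
      (.crossing 0 (k + 3), .slot 1)])
    (hQ' : HasArcs Q' [(.slot 0, .slot 1)]) :
    ∃ u : ℂ, u ^ 8 = 1 ∧ ∀ τ C, innerSum Q τ C = u * innerSum Q' τ C := by
  let p : Bool := decide (k.val % 2 = 1)
  -- The splitting that cuts off the kink as a circle contributes nothing. The other one is `true`
  -- in the model, hence `!p` before the shift by `k`.
  refine ⟨weight (!p), ?_, fun τ C => ?_⟩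
  · cases p <;> simp [weight, A_pow_eight]
  rw [innerSum_eq (ι := Equiv.sumEmpty (Fin 1) Empty) (ρ := ![k]) (e := kink)
      (e_darts_of_hasArcs (arcs := [(.inl (0, 0), .inl (0, 1)), (.inl (0, 2), .inr 0),
        (.inl (0, 3), .inr 1)]) (by simpa [darts, add_comm] using hQ) (by decide +kernel))
      consistent_kink,
    innerSum_eq (ι := Equiv.equivOfIsEmpty (Empty ⊕ Empty) (Fin 0)) (ρ := ![]) (e := arc)
      (e_darts_of_hasArcs (arcs := [(.inr 0, .inr 1)]) (by simpa [darts] using hQ')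
        (by decide +kernel)) consistent_arc, sum_bool_fin_one]
  have hs : ∀ a, states (Equiv.sumEmpty (Fin 1) Empty) ![k] ![a] τ = ![a ^^ p] := fun a => by
    ext i; fin_cases i; rfl
  simp only [hs, Fintype.sum_unique, Fintype.prod_empty, Fin.prod_univ_one, ← outcome_kink.2]
  cases p <;> simp [outcome_kink.1, value]

theorem innerSum_clasp {Q : Wiring (Fin 2) Empty Empty (Fin 4)}
    {Q' : Wiring Empty Empty Empty (Fin 4)} {r : Fin 4}
    (hQ : HasArcs Q [(.crossing 0 (0 + r), .slot 0), (.crossing 0 (1 + r), .slot 1),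
        (.crossing 0 (2 + r), .crossing 1 (0 + r)), (.crossing 0 (3 + r), .crossing 1 (3 + r)),
        (.crossing 1 (1 + r), .slot 2), (.crossing 1 (2 + r), .slot 3)])
    (hQ' : HasArcs Q' [(.slot 0, .slot 3), (.slot 1, .slot 2)]) (τ : Empty → Bool)
    (C : (Fin 4 → Fin 4 → Prop) → Prop) : innerSum Q τ C = innerSum Q' τ C := by
  rw [innerSum_eq (ι := Equiv.sumEmpty (Fin 2) Empty) (ρ := ![r, r]) (e := clasp)
      (e_darts_of_hasArcs (arcs := [(.inl (0, 0), .inr 0), (.inl (0, 1), .inr 1),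
        (.inl (0, 2), .inl (1, 0)), (.inl (0, 3), .inl (1, 3)), (.inl (1, 1), .inr 2),
        (.inl (1, 2), .inr 3)]) (by simpa [darts] using hQ) (by decide +kernel))
      consistent_clasp,
    innerSum_eq (ι := Equiv.equivOfIsEmpty (Empty ⊕ Empty) (Fin 0)) (ρ := ![]) (e := twoArcs)
      (e_darts_of_hasArcs (arcs := [(.inr 0, .inr 3), (.inr 1, .inr 2)])
        (by simpa [darts] using hQ') (by decide +kernel)) consistent_twoArcs, sum_bool_fin_two]
  let p : Bool := decide (r.val % 2 = 1)
  have hs : ∀ a b, states (Equiv.sumEmpty (Fin 2) Empty) ![r, r] ![a, b] τ =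
      ![a ^^ p, b ^^ p] := fun a b => by
    ext i; fin_cases i <;> rfl
  simp only [hs, Fintype.sum_unique, Fintype.prod_empty, Fin.prod_univ_two, Matrix.cons_val_zero,
    Matrix.cons_val_one, one_mul, ← outcome_clasp.2.2]
  refine sum_weight_mul_weight_mul p (fun a b => value C (outcome clasp ![a, b])) ?_ ?_
  · simp only [outcome_clasp.1, value]
  · simp only [outcome_clasp.2.1]

/-- The arcs of a strand north of a vertex. -/
def northArcs : List (Model 3 6 × Model 3 6) :=
  [(.inl (0, 0), .inr 0), (.inl (0, 1), .inr 1), (.inl (0, 2), .inl (1, 0)),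
    (.inl (0, 3), .inl (2, 0)), (.inl (1, 1), .inr 2), (.inl (1, 2), .inr 3),
    (.inl (1, 3), .inl (2, 1)), (.inl (2, 2), .inr 4), (.inl (2, 3), .inr 5)]

/-- The arcs of a strand south of a vertex. -/
def southArcs : List (Model 3 6 × Model 3 6) :=
  [(.inl (1, 0), .inr 0), (.inl (1, 1), .inl (2, 3)), (.inl (1, 2), .inl (0, 0)),
    (.inl (1, 3), .inr 5), (.inl (0, 1), .inl (2, 2)), (.inl (0, 2), .inr 3),
    (.inl (0, 3), .inr 4), (.inl (2, 0), .inr 1), (.inl (2, 1), .inr 2)]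

theorem mem_northArcs : ∀ u, ∃ q ∈ northArcs, q = (u, north u) ∨ q = (north u, u) := by
  decide +kernel

theorem mem_southArcs : ∀ u, ∃ q ∈ southArcs, q = (u, south u) ∨ q = (south u, u) := by
  decide +kernel

theorem innerSum_crossing {Q Q' : Wiring (Fin 3) Empty Empty (Fin 6)} {r s : Fin 4}
    (hQ : PassesNorth Q r 0 1 fun k => .crossing 2 (k + s))
    (hQ' : PassesSouth Q' r 0 1 fun k => .crossing 2 (k + s)) (τ : Empty → Bool)
    (C : (Fin 6 → Fin 6 → Prop) → Prop) : innerSum Q τ C = innerSum Q' τ C := by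
  rw [innerSum_eq (ι := Equiv.sumEmpty (Fin 3) Empty) (ρ := ![r, r, s]) (e := north)
      (e_darts_of_hasArcs (by simpa [darts, northArcs, PassesNorth] using hQ) mem_northArcs) consistent_north,
    innerSum_eq (ι := Equiv.sumEmpty (Fin 3) Empty) (ρ := ![r, r, s]) (e := south)
      (e_darts_of_hasArcs (by simpa [darts, southArcs, PassesSouth] using hQ') mem_southArcs)
      consistent_south, sum_bool_fin_three, sum_bool_fin_three]
  refine Finset.sum_congr rfl fun c _ => ?_
  have hs : ∀ a b, states (Equiv.sumEmpty (Fin 3) Empty) ![r, r, s] ![a, b, c] τ =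
      ![a ^^ decide (r.val % 2 = 1), b ^^ decide (r.val % 2 = 1),
        c ^^ decide (s.val % 2 = 1)] := fun a b => by
    ext i; fin_cases i <;> rfl
  have := congrArg (weight c * ·) (sum_north_eq_sum_south C (decide (r.val % 2 = 1))
    (c ^^ decide (s.val % 2 = 1)))
  simp only [Finset.mul_sum] at this
  simp only [hs, Fin.prod_univ_three]
  refine Eq.trans ?_ (this.trans ?_) <;>
  · refine Finset.sum_congr rfl fun a _ => Finset.sum_congr rfl fun b _ => ?_
    simp only [Matrix.cons_val]
    ring

/-- The two crossings and the hole of a type IV move as three vertices. -/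
def holeVertices : Fin 2 ⊕ Unit ≃ Fin 3 where
  toFun := Sum.elim ![0, 1] fun _ => 2
  invFun := ![.inl 0, .inl 1, .inr ()]
  left_inv := by decide
  right_inv := by decide

/-- Type III already holds for each smoothing of the third vertex separately, so that smoothing may
as well be prescribed by a filling. -/
theorem innerSum_hole {Q Q' : Wiring (Fin 2) Empty Unit (Fin 6)} {r s : Fin 4}
    (hQ : PassesNorth Q r 0 1 fun k => .hole () (k + s))
    (hQ' : PassesSouth Q' r 0 1 fun k => .hole () (k + s)) (τ : Unit → Bool)
    (C : (Fin 6 → Fin 6 → Prop) → Prop) : innerSum Q τ C = innerSum Q' τ C := by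
  rw [innerSum_eq (ι := holeVertices) (ρ := ![r, r, s]) (e := north)
      (e_darts_of_hasArcs (by simpa [darts, northArcs, holeVertices, PassesNorth] using hQ) mem_northArcs)
      consistent_north,
    innerSum_eq (ι := holeVertices) (ρ := ![r, r, s]) (e := south)
      (e_darts_of_hasArcs (by simpa [darts, southArcs, holeVertices, PassesSouth] using hQ') mem_southArcs)
      consistent_south, sum_bool_fin_two, sum_bool_fin_two]
  have hs : ∀ a b, states holeVertices ![r, r, s] ![a, b] τ =
      ![a ^^ decide (r.val % 2 = 1), b ^^ decide (r.val % 2 = 1),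
        τ () ^^ decide (s.val % 2 = 1)] := fun a b => by
    ext i; fin_cases i <;> rfl
  simp only [hs, Fin.prod_univ_two, Matrix.cons_val_zero, Matrix.cons_val_one]
  exact sum_north_eq_sum_south C _ _

theorem Move.exists_stateSum_eq_mul {n : ℕ} {D D' : Diagram n} (h : Move D D') :
    ∃ u : ℂ, u ^ 8 = 1 ∧
      ∀ τ c, stateSum D.wiring τ c = u * stateSum D'.wiring τ c := by
  induction h with
  | rename h =>
    exact ⟨1, one_pow _, fun τ c => by rw [one_mul]; exact h.stateSum_eq τ c⟩
  | subdivide h =>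
    exact ⟨1, one_pow _, fun τ c => by rw [one_mul]; exact h.stateSum_eq τ c⟩
  | typeI K Q Q' k hQ hQ' h h' =>
    obtain ⟨u, hu, hsum⟩ := innerSum_kink hQ hQ'
    exact ⟨u, hu, stateSum_eq_mul_of_innerSum h h' hsum⟩
  | typeII K Q Q' r hQ hQ' h h' =>
    exact ⟨1, one_pow _, stateSum_eq_mul_of_innerSum h h' fun τ C => by
      rw [one_mul, innerSum_clasp hQ hQ']⟩
  | typeIII K Q Q' r s hQ hQ' h h' =>
    exact ⟨1, one_pow _, stateSum_eq_mul_of_innerSum h h' fun τ C => by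
      rw [one_mul, innerSum_crossing hQ hQ']⟩
  | typeIV K Q Q' ε r s hQ hQ' h h' =>
    exact ⟨1, one_pow _, stateSum_eq_mul_of_innerSum h h' fun τ C => by
      rw [one_mul, innerSum_hole hQ hQ']⟩

theorem Isotopic.exists_stateSum_eq_mul {n : ℕ} {D D' : Diagram n} (h : Isotopic D D') :
    ∃ u : ℂ, u ^ 8 = 1 ∧
      ∀ τ c, stateSum D.wiring τ c = u * stateSum D'.wiring τ c := by
  induction h with
  | rel _ _ h => exact h.exists_stateSum_eq_mul
  | refl _ => exact ⟨1, one_pow _, fun _ _ => (one_mul _).symm⟩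
  | symm _ _ _ ih =>
    obtain ⟨u, hu, ih⟩ := ih
    have hu₀ : u ≠ 0 := by rintro rfl; simp at hu
    exact ⟨u⁻¹, by rw [inv_pow, hu, inv_one], fun τ c => by rw [ih, inv_mul_cancel_left₀ hu₀]⟩
  | trans _ _ _ _ _ ih ih' =>
    obtain ⟨u, hu, ih⟩ := ih
    obtain ⟨v, hv, ih'⟩ := ih'
    exact ⟨u * v, by rw [mul_pow, hu, hv, one_mul], fun τ c => by rw [ih, ih', mul_assoc]⟩

/-! ### Checkerboard colourings of planar diagrams -/

/-- Functions with values in `ZMod 2` that are constant along a relation. -/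
def invariants {D : Type} (r : D → D → Prop) : Submodule (ZMod 2) (D → ZMod 2) where
  carrier := {f | ∀ d d', r d d' → f d = f d'}
  add_mem' hf hg d d' h := by simp only [Pi.add_apply, hf d d' h, hg d d' h]
  zero_mem' _ _ _ := rfl
  smul_mem' c f hf d d' h := by simp only [Pi.smul_apply, hf d d' h]

/-- Turns the counts of vertices, edges, faces and components in Euler's formula into dimensions. -/
theorem finrank_invariants {D : Type} [Finite D] (r : D → D → Prop) :
    Module.finrank (ZMod 2) (invariants r) = Nat.card (Quot r) := by
  have := Fintype.ofFinite (Quot r)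
  let φ : invariants r ≃ₗ[ZMod 2] (Quot r → ZMod 2) :=
    { toFun := fun f => Quot.lift f.1 f.2
      map_add' := fun f g => by ext q; induction q using Quot.ind; rfl
      map_smul' := fun c f => by ext q; induction q using Quot.ind; rfl
      invFun := fun f => ⟨fun d => f (Quot.mk _ d), fun d d' h => congrArg f (Quot.sound h)⟩
      left_inv := fun f => rfl
      right_inv := fun f => by ext q; induction q using Quot.ind; rfl }
  rw [φ.finrank_eq, Module.finrank_fintype_fun_eq_card, Nat.card_eq_fintype_card]

theorem finrank_range_domRestrict {D : Type} [Finite D] {M : Type*} [AddCommGroup M]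
    [Module (ZMod 2) M] (L : (D → ZMod 2) →ₗ[ZMod 2] M) {V C : Submodule (ZMod 2) (D → ZMod 2)}
    (hCV : C ≤ V) (h : ∀ f ∈ V, L f = 0 ↔ f ∈ C) :
    Module.finrank (ZMod 2) (LinearMap.range (L.domRestrict V)) + Module.finrank (ZMod 2) C =
      Module.finrank (ZMod 2) V := by
  suffices hC : C = (LinearMap.ker (L.domRestrict V)).map V.subtype by
    rw [← LinearMap.finrank_range_add_finrank_ker (L.domRestrict V),
      ← Submodule.finrank_map_subtype_eq V (LinearMap.ker (L.domRestrict V)), ← hC]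
  ext f
  simp only [Submodule.mem_map, LinearMap.mem_ker, LinearMap.domRestrict_apply,
    Submodule.subtype_apply, Subtype.exists, exists_and_left, exists_prop, exists_eq_right_right]
  exact ⟨fun hf => ⟨(h f (hCV hf)).2 hf, hCV hf⟩, fun hf => (h f hf.2).1 hf.1⟩

section Coloring

variable {D : Type} (e : D → D)

/-- The coboundary map, with values in the functions on the edges. -/
def coboundary (he : ∀ d, e (e d) = d) : (D → ZMod 2) →ₗ[ZMod 2] invariants fun d d' => d' = e d where
  toFun f := ⟨fun d => f d + f (e d), by
    rintro d _ rfl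
    simp only [he, add_comm]⟩
  map_add' f g := by
    ext d
    simp only [Submodule.coe_add, Pi.add_apply]
    ring
  map_smul' c f := by
    ext d
    simp [mul_add]

/-- The pairing of functions on the darts with functions on the edges. -/
def edgePairing [Fintype D] :
    (D → ZMod 2) →ₗ[ZMod 2] Module.Dual (ZMod 2) (invariants fun d d' => d' = e d) where
  toFun v :=
    { toFun := fun w => ∑ d, v d * w.1 d
      map_add' := fun w w' => by simp [mul_add, Finset.sum_add_distrib]
      map_smul' := fun c w => by simp [Finset.mul_sum, mul_left_comm] }
  map_add' v v' := by ext w; simp [add_mul, Finset.sum_add_distrib]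
  map_smul' c v := by ext w; simp [Finset.mul_sum, mul_assoc]

theorem edgePairing_eq_zero_iff [Fintype D] (he : ∀ d, e (e d) = d) (hne : ∀ d, e d ≠ d)
    (v : D → ZMod 2) : edgePairing e v = 0 ↔ ∀ d, v (e d) = v d := by
  classical
  constructor
  · intro h d
    -- Test against the indicator function of a single edge.
    have hinv : (Pi.single d 1 + Pi.single (e d) 1 : D → ZMod 2) ∈
        invariants fun d d' => d' = e d := by
      rintro x _ rfl
      have h₁ : e x = d ↔ x = e d := ⟨fun h => by rw [← h, he], fun h => by rw [h, he]⟩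
      have h₂ : e x = e d ↔ x = d := ⟨fun h => by rw [← he x, h, he], fun h => by rw [h]⟩
      simp only [Pi.add_apply, Pi.single_apply, h₁, h₂]
      exact add_comm _ _
    have := LinearMap.congr_fun h ⟨_, hinv⟩
    simp only [edgePairing, LinearMap.coe_mk, AddHom.coe_mk, Pi.add_apply, mul_add,
      Finset.sum_add_distrib, Pi.single_apply, mul_ite, mul_one, mul_zero, Finset.sum_ite_eq',
      Finset.mem_univ, if_true, LinearMap.zero_apply] at this
    exact (CharTwo.add_eq_zero.1 this).symm
  · intro h
    ext w
    refine Finset.sum_involution (fun d _ => e d) (fun d _ => ?_) (fun d _ _ => hne d)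
      (fun _ _ => Finset.mem_univ _) fun d _ => he d
    rw [h, ← w.2 d _ rfl, CharTwo.add_self_eq_zero]

/-- The coboundaries of face functions are orthogonal to the vertex functions, and Euler's formula
makes them the full orthogonal complement. The constant `1` lies in it because every vertex has even
degree, as the alternating function `p` shows; a face function with coboundary `1` is the colouring.
-/
theorem exists_coloring [Finite D] (he : ∀ d, e (e d) = d) (hne : ∀ d, e d ≠ d)
    (ρ : Equiv.Perm D) (p : D → ZMod 2) (hp : ∀ d, p (ρ d) = p d + 1)
    (hχ : Nat.card (Quot fun d d' => d' = ρ d) + Nat.card (Quot fun d d' => d' = ρ (e d)) =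
      Nat.card (Quot fun d d' => d' = e d) + 2 * Nat.card (Quot fun d d' => d' = ρ d ∨ d' = e d)) :
    ∃ g : D → ZMod 2, (∀ d, g (ρ d) = g d + 1) ∧ ∀ d, g (e d) = g d + 1 := by
  have := Fintype.ofFinite D
  simp only [← finrank_invariants] at hχ
  set V := invariants fun d d' => d' = ρ d with hV
  set F := invariants fun d d' => d' = ρ (e d) with hF
  set W := invariants fun d d' => d' = e d with hW
  set C := invariants fun d d' => d' = ρ d ∨ d' = e d with hC
  have hCV : C ≤ V := fun f hf d d' h => hf d d' (.inl h)
  have hCF : C ≤ F := by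
    rintro f hf d _ rfl
    exact (hf d _ (.inr rfl)).trans (hf _ _ (.inl rfl))
  have hδ := finrank_range_domRestrict (coboundary e he) hCF fun f hf => by
    have : coboundary e he f = 0 ↔ ∀ d, f d = f (e d) := by
      rw [Subtype.ext_iff, funext_iff]
      exact forall_congr' fun d => CharTwo.add_eq_zero
    rw [this]
    refine ⟨?_, fun h d => h d _ (.inr rfl)⟩
    rintro h d _ (rfl | rfl)
    · have := hf (e d) _ rfl
      rw [he] at this
      rw [h, this]
    · exact h d
  have hβ := finrank_range_domRestrict (edgePairing e) hCV fun f hf => by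
    rw [edgePairing_eq_zero_iff e he hne]
    refine ⟨?_, fun h d => (h d _ (.inr rfl)).symm⟩
    rintro h d _ (rfl | rfl)
    · exact hf d _ rfl
    · exact (h d).symm
  set Φ := LinearMap.range ((edgePairing e).domRestrict V) with hΦ
  have hN : Module.finrank (ZMod 2) Φ + Module.finrank (ZMod 2) Φ.dualCoannihilator =
      Module.finrank (ZMod 2) W := Subspace.finrank_add_finrank_dualCoannihilator_eq Φ
  have hmem : ∀ w : W, w ∈ Φ.dualCoannihilator ↔ ∀ v ∈ V, ∑ d, v d * w.1 d = 0 := by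
    intro w
    rw [Submodule.mem_dualCoannihilator]
    constructor
    · exact fun h v hv => h _ ⟨⟨v, hv⟩, rfl⟩
    · rintro h _ ⟨⟨v, hv⟩, rfl⟩
      exact h v hv
  have hle : LinearMap.range ((coboundary e he).domRestrict F) ≤ Φ.dualCoannihilator := by
    rintro _ ⟨⟨g, hg⟩, rfl⟩
    rw [hmem]
    intro v hv
    let ε : Equiv.Perm D := ⟨e, e, he, he⟩
    change ∑ d, v d * (g d + g (e d)) = 0
    have h₁ : ∑ d, v d * g d = ∑ d, v d * g (e d) := by
      rw [← Equiv.sum_comp (ε.trans ρ), ← Equiv.sum_comp ε fun d => v d * g (e d)]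
      refine Finset.sum_congr rfl fun d _ => ?_
      change v (ρ (e d)) * g (ρ (e d)) = v (e d) * g (e (e d))
      rw [← hg d _ rfl, ← hv (e d) _ rfl, he]
    simp only [mul_add, Finset.sum_add_distrib]
    rw [h₁, CharTwo.add_self_eq_zero]
  -- Both maps have kernel `C`, so the dimensions are `f - c` and `e - (v - c)`, which agree by
  -- Euler's formula.
  have heq : LinearMap.range ((coboundary e he).domRestrict F) = Φ.dualCoannihilator :=
    Submodule.eq_of_le_of_finrank_eq hle (by omega)
  have hone : (⟨1, fun _ _ _ => rfl⟩ : W) ∈ Φ.dualCoannihilator := by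
    rw [hmem]
    intro v hv
    have h₁ : ∑ d, v d * p d = ∑ d, v d * (p d + 1) := by
      rw [← Equiv.sum_comp ρ]
      exact Finset.sum_congr rfl fun d _ => by rw [← hv d _ rfl, hp]
    simp only [mul_add, Finset.sum_add_distrib] at h₁
    exact left_eq_add.1 h₁
  rw [← heq] at hone
  obtain ⟨⟨g, hg⟩, h⟩ := hone
  have h₁ : ∀ d, g d + g (e d) = 1 := fun d => congrFun (congrArg Subtype.val h) d
  have h₂ : ∀ d, g (e d) = g d + 1 := fun d => by
    rw [← h₁ d, ← add_assoc, CharTwo.add_self_eq_zero, zero_add]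
  refine ⟨g, fun d => ?_, h₂⟩
  rw [← h₂]
  have := hg (e d) _ rfl
  rw [he] at this
  exact this.symm

end Coloring

/-- The rotation of the darts around the vertices as a permutation. -/
def rotEquiv (X P : Type) (n : ℕ) : Equiv.Perm (Dart X P (Fin n) (Fin 4)) where
  toFun := rot
  invFun
    | .crossing x k => .crossing x (k - 1)
    | .point p k => .point p (k - 1)
    | .hole h k => .hole h (k - 1)
    | .slot b => .slot (b + 1)
  left_inv d := by cases d <;> simp [rot]
  right_inv d := by cases d <;> simp [rot]

theorem Diagram.exists_coloring {n : ℕ} (T : Diagram n) :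
    ∃ g : Dart T.X T.P (Fin n) (Fin 4) → ZMod 2, (∀ d, g (rot d) = g d + 1) ∧
      ∀ d, g (T.wiring.e d) = g d + 1 := by
  refine PuncturedTangle.exists_coloring T.wiring.e T.wiring.e_e T.wiring.e_ne (rotEquiv T.X T.P n)
    (fun d => match d with
      | .crossing _ k => k.val
      | .point _ k => k.val
      | .hole _ k => k.val
      | .slot b => b.val) ?_ T.planar
  have h₂ : ∀ k : Fin 2, (((k + 1 : Fin 2).val : ℕ) : ZMod 2) = (k.val : ZMod 2) + 1 := by decide
  have h₄ : ∀ k : Fin 4, (((k + 1 : Fin 4).val : ℕ) : ZMod 2) = (k.val : ZMod 2) + 1 := by decide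
  have h₄' : ∀ k : Fin 4, (((k - 1 : Fin 4).val : ℕ) : ZMod 2) = (k.val : ZMod 2) + 1 := by decide
  rintro (⟨x, k⟩ | ⟨p, k⟩ | ⟨h, k⟩ | b)
  · exact h₄ k
  · exact h₂ k
  · exact h₄ k
  · exact h₄' b

/-! ### The parity of monocyclic states -/

section Sign

variable {B : Type} [Fintype B] [DecidableEq B] [Nontrivial B]

theorem sign_of_forall_sameCycle (π : Equiv.Perm B) (h : ∀ a b, π.SameCycle a b) :
    Equiv.Perm.sign π = -(-1) ^ Fintype.card B := by
  have hne : ∀ a, π a ≠ a := fun a ha => by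
    obtain ⟨b, hb⟩ := exists_ne a
    obtain ⟨k, hk⟩ := h a b
    exact hb (by rw [← hk, Equiv.Perm.zpow_apply_eq_self_of_apply_eq_self ha])
  have hc : π.IsCycle := by
    obtain ⟨a⟩ := (inferInstance : Nonempty B)
    exact ⟨a, hne a, fun b _ => h a b⟩
  have hs : π.support = Finset.univ := by
    ext a
    simp [hne]
  rw [hc.sign, hs, Finset.card_univ]

end Sign

variable {X P H : Type}

/-- The darts at the four-valent vertices, the outer boundary being one of them. -/
def vertexDart (P : Type) : X ⊕ H ⊕ Unit → Fin 4 → Dart X P H (Fin 4)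
  | .inl x, k => .crossing x k
  | .inr (.inl h), k => .hole h k
  | .inr (.inr _), k => .slot k

theorem vertexDart_injective {y y' : X ⊕ H ⊕ Unit} {k k' : Fin 4}
    (h : vertexDart P y k = vertexDart P y' k') : y = y' ∧ k = k' := by
  rcases y with x | i | ⟨⟩ <;> rcases y' with x' | i' | ⟨⟩ <;> simp_all [vertexDart]

/-- The darts after smoothing all four-valent vertices. -/
def smoothAll (t : X ⊕ H ⊕ Unit → Bool) : Dart X P H (Fin 4) → Dart X P H (Fin 4) :=
  resolve (t ∘ .inl) (t ∘ .inr ∘ .inl) (smooth (t (.inr (.inr ()))))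

theorem smoothAll_vertexDart (t : X ⊕ H ⊕ Unit → Bool) (y : X ⊕ H ⊕ Unit) (k : Fin 4) :
    smoothAll t (vertexDart P y k) = vertexDart P y (smooth (t y) k) := by
  rcases y with x | i | ⟨⟩ <;> rfl

theorem smoothAll_point (t : X ⊕ H ⊕ Unit → Bool) (p : P) (k : Fin 2) :
    smoothAll t (.point p k) = .point p (k + 1) := rfl

theorem fin_two_add_one_add_one : ∀ k : Fin 2, k + 1 + 1 = k := by decide

theorem dart_cases (d : Dart X P H (Fin 4)) :
    (∃ y k, d = vertexDart P y k) ∨ ∃ p k, d = .point p k := by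
  rcases d with ⟨x, k⟩ | ⟨p, k⟩ | ⟨h, k⟩ | k
  · exact .inl ⟨.inl x, k, rfl⟩
  · exact .inr ⟨p, k, rfl⟩
  · exact .inl ⟨.inr (.inl h), k, rfl⟩
  · exact .inl ⟨.inr (.inr ()), k, rfl⟩

theorem smoothAll_smoothAll (t : X ⊕ H ⊕ Unit → Bool) (d : Dart X P H (Fin 4)) :
    smoothAll t (smoothAll t d) = d := by
  rcases dart_cases d with ⟨y, k, rfl⟩ | ⟨p, k, rfl⟩
  · rw [smoothAll_vertexDart, smoothAll_vertexDart, smooth_smooth]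
  · rw [smoothAll_point, smoothAll_point, fin_two_add_one_add_one]

/-- A checkerboard colouring of the regions, as a function on the darts. -/
structure IsColoring (w : Wiring X P H (Fin 4)) (g : Dart X P H (Fin 4) → ZMod 2) : Prop where
  vertex : ∀ y k, g (vertexDart P y k) = g (vertexDart P y 0) + (k.val : ℕ)
  point : ∀ p k, g (.point p (k + 1)) = g (.point p k) + 1
  wiring : ∀ d, g (w.e d) = g d + 1

theorem Diagram.exists_isColoring {n : ℕ} (T : Diagram n) : ∃ g, IsColoring T.wiring g := by
  obtain ⟨g, hrot, he⟩ := T.exists_coloring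
  refine ⟨g, ⟨?_, fun p k => hrot (.point p k), he⟩⟩
  have key : ∀ f : Fin 4 → ZMod 2, (∀ k, f (k + 1) = f k + 1) → ∀ k, f k = f 0 + (k.val : ℕ) := by
    intro f hf k
    have h₁ := hf 0
    have h₂ := hf 1
    have h₃ := hf 2
    fin_cases k
    · simp
    · simpa using h₁
    · exact h₂.trans ((congrArg (· + 1) h₁).trans (add_assoc _ _ _))
    · exact h₃.trans (((congrArg (· + 1) h₂).trans (congrArg (· + 1 + 1) h₁)).trans (by
        simp only [add_assoc]; rfl))
  rintro (x | i | ⟨⟩) k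
  · exact key (fun k => g (.crossing x k)) (fun k => hrot (.crossing x k)) k
  · exact key (fun k => g (.hole i k)) (fun k => hrot (.hole i k)) k
  · refine key (fun k => g (.slot k)) (fun k => ?_) k
    have := hrot (.slot (k + 1))
    simp only [rot, add_sub_cancel_right] at this
    rw [this, add_assoc, CharTwo.add_self_eq_zero, add_zero]

theorem val_smooth : ∀ (b : Bool) (k : Fin 4),
    (((smooth b k).val : ℕ) : ZMod 2) = (k.val : ℕ) + 1 := by decide

namespace IsColoring

variable {w : Wiring X P H (Fin 4)} {g : Dart X P H (Fin 4) → ZMod 2}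

theorem smoothAll (hg : IsColoring w g) (t : X ⊕ H ⊕ Unit → Bool) (d : Dart X P H (Fin 4)) :
    g (PuncturedTangle.smoothAll t d) = g d + 1 := by
  rcases dart_cases d with ⟨y, k, rfl⟩ | ⟨p, k, rfl⟩
  · rw [smoothAll_vertexDart, hg.vertex, hg.vertex y k, val_smooth, add_assoc]
  · exact hg.point p k

/-- The darts of colour `0`. -/
abbrev Black (g : Dart X P H (Fin 4) → ZMod 2) : Type := {d // g d = 0}

theorem one_add_one : (1 : ZMod 2) + 1 = 0 := by decide

/-- Running along a circle of the resolved diagram, from one dart of colour `0` to the next. -/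
def next (hg : IsColoring w g) (t : X ⊕ H ⊕ Unit → Bool) : Equiv.Perm (Black g) where
  toFun d := ⟨PuncturedTangle.smoothAll t (w.e d), by
    rw [hg.smoothAll, hg.wiring, d.2, zero_add, one_add_one]⟩
  invFun d := ⟨w.e (PuncturedTangle.smoothAll t d), by
    rw [hg.wiring, hg.smoothAll, d.2, zero_add, one_add_one]⟩
  left_inv d := Subtype.ext (by simp only [smoothAll_smoothAll, w.e_e])
  right_inv d := Subtype.ext (by simp only [smoothAll_smoothAll, w.e_e])

/-- The change from one smoothing to another one. -/
def change (hg : IsColoring w g) (t t' : X ⊕ H ⊕ Unit → Bool) : Equiv.Perm (Black g) where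
  toFun d := ⟨PuncturedTangle.smoothAll t' (PuncturedTangle.smoothAll t d), by
    rw [hg.smoothAll, hg.smoothAll, d.2, zero_add, one_add_one]⟩
  invFun d := ⟨PuncturedTangle.smoothAll t (PuncturedTangle.smoothAll t' d), by
    rw [hg.smoothAll, hg.smoothAll, d.2, zero_add, one_add_one]⟩
  left_inv d := Subtype.ext (by simp only [smoothAll_smoothAll])
  right_inv d := Subtype.ext (by simp only [smoothAll_smoothAll])

theorem change_mul_next (hg : IsColoring w g) (t t' : X ⊕ H ⊕ Unit → Bool) :
    hg.change t t' * hg.next t = hg.next t' :=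
  Equiv.ext fun d => Subtype.ext (by
    change PuncturedTangle.smoothAll t' (PuncturedTangle.smoothAll t
      (PuncturedTangle.smoothAll t (w.e d))) = PuncturedTangle.smoothAll t' (w.e d)
    rw [smoothAll_smoothAll])

theorem sameCycle_next (hg : IsColoring w g) (t : X ⊕ H ⊕ Unit → Bool)
    (h : Monocyclic w (t ∘ .inl) (t ∘ .inr ∘ .inl) (smooth (t (.inr (.inr ())))))
    (a b : Black g) : (hg.next t).SameCycle a b := by
  -- Exactly one end of each arc is black; the property says that this end lies in the cycle of `a`.
  let p : Dart X P H (Fin 4) → Prop := fun d => (∀ h : g d = 0, (hg.next t).SameCycle a ⟨d, h⟩) ∧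
    ∀ h : g (w.e d) = 0, (hg.next t).SameCycle a ⟨w.e d, h⟩
  have hcol : ∀ z : ZMod 2, z = 0 ∧ z + 1 ≠ 0 ∨ z ≠ 0 ∧ z + 1 = 0 := by decide
  have hp : ∀ c d, Adjacent w (t ∘ .inl) (t ∘ .inr ∘ .inl) (smooth (t (.inr (.inr ())))) c d →
      (p c ↔ p d) := by
    rintro c _ (rfl | rfl)
    · simp only [p, w.e_e]
      exact And.comm
    · change p c ↔ p (PuncturedTangle.smoothAll t c)
      have h₁ := hg.smoothAll t c
      have h₂ := hg.wiring c
      have h₃ := hg.wiring (PuncturedTangle.smoothAll t c)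
      rcases hcol (g c) with ⟨h0, h0'⟩ | ⟨h0, h0'⟩
      · have h4 : g (w.e (PuncturedTangle.smoothAll t c)) = 0 := by
          rw [h₃, h₁, h0, zero_add, one_add_one]
        have h5 : hg.next t ⟨_, h4⟩ = ⟨c, h0⟩ := Subtype.ext (by
          change PuncturedTangle.smoothAll t (w.e (w.e (PuncturedTangle.smoothAll t c))) = c
          rw [w.e_e, smoothAll_smoothAll])
        have h6 := Equiv.Perm.sameCycle_apply_right (f := hg.next t) (x := a) (y := ⟨_, h4⟩)
        rw [h5] at h6
        exact ⟨fun hc => ⟨fun h => (h0' (h₁ ▸ h)).elim, fun _ => h6.1 (hc.1 h0)⟩,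
          fun hc => ⟨fun _ => h6.2 (hc.2 h4), fun h => (h0' (h₂ ▸ h)).elim⟩⟩
      · have h4 : g (w.e c) = 0 := h₂.trans h0'
        have h5 : hg.next t ⟨_, h4⟩ = ⟨PuncturedTangle.smoothAll t c, h₁.trans h0'⟩ :=
          Subtype.ext (by
            change PuncturedTangle.smoothAll t (w.e (w.e c)) = _
            rw [w.e_e])
        have h6 := Equiv.Perm.sameCycle_apply_right (f := hg.next t) (x := a) (y := ⟨_, h4⟩)
        rw [h5] at h6
        refine ⟨fun hc => ⟨fun _ => h6.2 (hc.2 h4), fun h => ?_⟩,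
          fun hc => ⟨fun h => (h0 h).elim, fun _ => h6.1 (hc.1 (h₁.trans h0'))⟩⟩
        rw [h₃, h₁, h0', zero_add] at h
        exact (one_ne_zero h).elim
  refine ((eqvGen_iff_of_forall hp (h a.1 b.1)).1 ⟨fun _ => .refl _ _, fun h => ?_⟩).1 b.2
  rw [hg.wiring, a.2, zero_add] at h
  exact (one_ne_zero h).elim

/-- The two positions of colour `0` at a vertex at which the position `0` has colour `a`. -/
def blackIndex (a : ZMod 2) (j : Fin 2) : Fin 4 := if a = 0 then ![0, 2] j else ![1, 3] j

theorem add_blackIndex : ∀ a j, a + ((blackIndex a j).val : ℕ) = 0 := by decide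

theorem exists_blackIndex : ∀ (a : ZMod 2) (k : Fin 4), a + (k.val : ℕ) = 0 →
    ∃ j, blackIndex a j = k := by decide

theorem blackIndex_injective : ∀ a j j', blackIndex a j = blackIndex a j' → j = j' := by decide

theorem smooth_smooth_blackIndex : ∀ b b' a j, smooth b' (smooth b (blackIndex a j)) =
    blackIndex a ((if b = b' then 1 else Equiv.swap 0 1 : Equiv.Perm (Fin 2)) j) := by decide

/-- The dart of colour `0` with a given index at a vertex. -/
def blackDart (hg : IsColoring w g) (q : (X ⊕ H ⊕ Unit) × Fin 2) : Black g :=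
  ⟨vertexDart P q.1 (blackIndex (g (vertexDart P q.1 0)) q.2), by
    rw [hg.vertex, add_blackIndex]⟩

theorem blackDart_injective (hg : IsColoring w g) : Function.Injective hg.blackDart := by
  rintro ⟨y, j⟩ ⟨y', j'⟩ h
  obtain ⟨h₁, h₂⟩ := vertexDart_injective (congrArg Subtype.val h)
  dsimp only at h₁ h₂
  subst h₁
  rw [blackIndex_injective _ _ _ h₂]

/-- Every four-valent vertex has two black darts, opposite to each other. A changed smoothing swaps
them, and everything else is fixed. -/
theorem sign_change [Fintype X] [DecidableEq X] [Fintype H] [DecidableEq H] [Fintype (Black g)]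
    [DecidableEq (Black g)] (hg : IsColoring w g) (t t' : X ⊕ H ⊕ Unit → Bool) :
    Equiv.Perm.sign (hg.change t t') = ∏ y, if t y = t' y then 1 else -1 := by
  let f : Equiv.Perm ((X ⊕ H ⊕ Unit) × Fin 2) :=
    Equiv.prodCongrRight fun y => if t y = t' y then 1 else Equiv.swap 0 1
  have hf : ∀ q, hg.change t t' (hg.blackDart q) = hg.blackDart (f q) := by
    rintro ⟨y, j⟩
    refine Subtype.ext ?_
    change PuncturedTangle.smoothAll t' (PuncturedTangle.smoothAll t (vertexDart P y _)) =
      vertexDart P y _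
    rw [smoothAll_vertexDart, smoothAll_vertexDart, smooth_smooth_blackIndex]
    rfl
  have hsign : Equiv.Perm.sign f = ∏ y, if t y = t' y then 1 else -1 := by
    rw [Equiv.Perm.sign_prodCongrRight]
    refine Finset.prod_congr rfl fun y _ => ?_
    split_ifs
    · exact Equiv.Perm.sign_one
    · exact Equiv.Perm.sign_swap (by decide)
  rw [← hsign]
  symm
  refine Equiv.Perm.sign_bij (fun q _ => hg.blackDart q) (fun q _ _ => (hf q).symm)
    (fun _ _ _ _ h => hg.blackDart_injective h) ?_
  rintro ⟨d, hd⟩ hne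
  rcases dart_cases d with ⟨y, k, rfl⟩ | ⟨p, k, rfl⟩
  · obtain ⟨j, hj⟩ := exists_blackIndex (g (vertexDart P y 0)) k (by rw [← hg.vertex, hd])
    have hq : hg.blackDart (y, j) = ⟨vertexDart P y k, hd⟩ := Subtype.ext (by
      change vertexDart P y _ = _
      rw [hj])
    refine ⟨(y, j), fun h => hne ?_, hq⟩
    rw [← hq, hf, h]
  · refine (hne (Subtype.ext ?_)).elim
    change PuncturedTangle.smoothAll t' (PuncturedTangle.smoothAll t (.point p k)) = _
    rw [smoothAll_point, smoothAll_point, fin_two_add_one_add_one]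

/-- Two smoothings with a single circle differ at an even number of vertices. -/
theorem prod_eq_one_of_monocyclic [Fintype X] [Finite P] [Fintype H] (hg : IsColoring w g)
    {t t' : X ⊕ H ⊕ Unit → Bool}
    (h : Monocyclic w (t ∘ .inl) (t ∘ .inr ∘ .inl) (smooth (t (.inr (.inr ())))))
    (h' : Monocyclic w (t' ∘ .inl) (t' ∘ .inr ∘ .inl) (smooth (t' (.inr (.inr ()))))) :
    ∏ y, (if t y = t' y then 1 else -1 : ℤˣ) = 1 := by
  classical
  have := Fintype.ofFinite (Black g)
  have : Nontrivial (Black g) :=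
    ⟨hg.blackDart (.inr (.inr ()), 0), hg.blackDart (.inr (.inr ()), 1), fun h => by
      have := hg.blackDart_injective h
      simp at this⟩
  rw [← hg.sign_change]
  have h₁ := congrArg Equiv.Perm.sign (hg.change_mul_next t t')
  rw [Equiv.Perm.sign_mul, sign_of_forall_sameCycle _ (hg.sameCycle_next t h),
    sign_of_forall_sameCycle _ (hg.sameCycle_next t' h')] at h₁
  exact mul_eq_right.1 h₁

end IsColoring

/-! ### Integrality -/

theorem Diagram.exists_sq_eq_one {n : ℕ} (T : Diagram n) :
    ∃ z : ℂ, z ^ 8 = 1 ∧ ∀ (σ : T.X → Bool) (α : Fin n → Fin 2) (j : Fin 2),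
      Monocyclic T.wiring σ (fill α) (outer j) →
      (z * ((-Complex.I) ^ (∑ h, (α h).val) * Complex.I ^ j.val * ∏ x, weight (σ x))) ^ 2 = 1 := by
  obtain ⟨g, hg⟩ := T.exists_isColoring
  by_cases h₀ : ∃ t : T.X ⊕ Fin n ⊕ Unit → Bool,
    Monocyclic T.wiring (t ∘ .inl) (t ∘ .inr ∘ .inl) (smooth (t (.inr (.inr ()))))
  swap
  · refine ⟨1, one_pow _, fun σ α j h => (h₀ ?_).elim⟩
    exact ⟨Sum.elim σ (Sum.elim (fill α) fun _ => decide (j = 0)), h⟩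
  obtain ⟨t₀, ht₀⟩ := h₀
  let φ : Bool → ℂ := fun b => if b then Complex.I else 1
  let ψ : Bool → ℂ := fun b => if b then -1 else 1
  have hφ : ∀ b, φ b ^ 2 = ψ b := fun b => by cases b <;> simp [φ, ψ]
  have hφ8 : ∀ b, φ b ^ 8 = 1 := fun b => by
    rw [show φ b ^ 8 = (φ b ^ 2) ^ 4 by ring, hφ]
    cases b <;> norm_num [ψ]
  -- After squaring, `A ^ card` and `I` turn the weights and `I ^ j` into the signs `ψ` of the
  -- crossings and the outer vertex. The last factor squares to the sign of the reference smoothing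
  -- `t₀`, and the two signs agree by parity.
  refine ⟨A ^ Fintype.card T.X * Complex.I * ∏ y, φ (t₀ y), ?_, fun σ α j h => ?_⟩
  · rw [mul_pow, mul_pow, ← pow_mul, mul_comm _ 8, pow_mul, A_pow_eight, one_pow,
      show Complex.I ^ 8 = (Complex.I ^ 4) ^ 2 by ring, Complex.I_pow_four, ← Finset.prod_pow]
    simp [hφ8]
  let t : T.X ⊕ Fin n ⊕ Unit → Bool := Sum.elim σ (Sum.elim (fill α) fun _ => decide (j = 0))
  have hprod := hg.prod_eq_one_of_monocyclic ht₀ (t' := t) h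
  have hprod' : (∏ y, ψ (t₀ y)) * ∏ y, ψ (t y) = 1 := by
    rw [← Finset.prod_mul_distrib]
    have := congrArg (fun u : ℤˣ => ((u : ℤ) : ℂ)) hprod
    simp only [Units.coe_prod, Int.cast_prod, Units.val_one, Int.cast_one] at this
    rw [← this]
    refine Finset.prod_congr rfl fun y _ => ?_
    cases t₀ y <;> cases t y <;> simp [ψ]
  have h₁ : (A ^ Fintype.card T.X) ^ 2 * (∏ x, weight (σ x)) ^ 2 = ∏ x, ψ (σ x) := by
    rw [← Finset.card_univ, ← Finset.prod_const, ← mul_pow, ← Finset.prod_mul_distrib,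
      ← Finset.prod_pow]
    refine Finset.prod_congr rfl fun x _ => ?_
    rw [mul_pow, A_sq]
    cases σ x
    · simp only [weight, ψ, Bool.false_eq_true, if_false, A_inv_sq, mul_neg, Complex.I_mul_I,
        neg_neg]
    · simp only [weight, ψ, if_true, A_sq, Complex.I_mul_I]
  have h₂ : ((-Complex.I) ^ (∑ h, (α h).val)) ^ 2 = ∏ h, ψ (fill α h) := by
    rw [← Finset.prod_pow_eq_pow_sum, ← Finset.prod_pow]
    refine Finset.prod_congr rfl fun i _ => ?_
    obtain h | h : α i = 0 ∨ α i = 1 := by omega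
    · simp [fill, ψ, h]
    · simp [fill, ψ, h]
  have h₃ : Complex.I ^ 2 * (Complex.I ^ j.val) ^ 2 = ψ (decide (j = 0)) := by
    obtain rfl | rfl : j = 0 ∨ j = 1 := by omega
    · simp [ψ]
    · simp [ψ]
  have h₄ : ∏ y, ψ (t y) = (∏ x, ψ (σ x)) * ((∏ h, ψ (fill α h)) * ψ (decide (j = 0))) := by
    simp [Fintype.prod_sum_type, t]
  have h₅ : (∏ y, φ (t₀ y)) ^ 2 = ∏ y, ψ (t₀ y) := by simp only [← Finset.prod_pow, hφ]
  rw [h₄, ← h₁, ← h₂, ← h₃, ← h₅] at hprod'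
  rw [← hprod']
  ring

theorem Diagram.exists_mul_stateSum_mem {n : ℕ} (T : Diagram n) :
    ∃ z : ℂ, z ^ 8 = 1 ∧ ∀ (α : Fin n → Fin 2) (j : Fin 2),
      z * ((-Complex.I) ^ (∑ h, (α h).val) * Complex.I ^ j.val *
        stateSum T.wiring (fill α) (outer j)) ∈ (Int.castRingHom ℂ).range := by
  obtain ⟨z, hz, h⟩ := T.exists_sq_eq_one
  refine ⟨z, hz, fun α j => ?_⟩
  rw [stateSum_eq_sum, Finset.mul_sum, Finset.mul_sum]
  refine sum_mem fun σ _ => ?_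
  rw [← mul_assoc, ← mul_assoc]
  by_cases hσ : Monocyclic T.wiring σ (fill α) (outer j)
  · rw [if_pos hσ, mul_one, mul_assoc]
    rcases sq_eq_one_iff.1 (h σ α j hσ) with h' | h'
    · rw [h']
      exact one_mem _
    · rw [h']
      exact neg_mem (one_mem _)
  · rw [if_neg hσ, mul_zero]
    exact zero_mem _

/-! ### Exponents as digit sums, and uniqueness up to sign -/

theorem length_tSeq (n : ℕ) : (tSeq n).length = 2 ^ n := by
  induction n with
  | zero => rfl
  | succ n ih => simp [tSeq, ih, pow_succ, mul_two]

/-- The second half of the sequence consists of the indices with leading binary digit `1`, which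
accounts for the increment. -/
theorem getD_tSeq (n i : ℕ) (hi : i < 2 ^ n) :
    (tSeq n).getD i 0 = ∑ k ∈ Finset.range n, i / 2 ^ k % 2 := by
  induction n generalizing i with
  | zero =>
    obtain rfl : i = 0 := by simpa using hi
    rfl
  | succ n ih =>
    rw [Finset.sum_range_succ, tSeq]
    rcases lt_or_ge i (2 ^ n) with h | h
    · rw [List.getD_append _ _ _ _ (by rwa [length_tSeq]), ih i h, Nat.div_eq_of_lt h, Nat.zero_mod,
        add_zero]
    · obtain ⟨j, rfl⟩ := Nat.exists_eq_add_of_le h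
      have hj : j < 2 ^ n := by rw [pow_succ] at hi; omega
      have hlen : (tSeq n).length ≤ 2 ^ n + j := by rw [length_tSeq]; omega
      rw [List.getD_append_right _ _ _ _ hlen, length_tSeq, Nat.add_sub_cancel_left,
        Nat.add_div_left _ (by positivity), Nat.div_eq_of_lt hj]
      have h₁ : ((tSeq n).map (· + 1)).getD j 0 = (tSeq n).getD j 0 + 1 := by
        have hj' : j < (tSeq n).length := by rwa [length_tSeq]
        simp [List.getD, hj']
      rw [h₁, ih j hj]
      congr 1
      refine Finset.sum_congr rfl fun k hk => ?_
      obtain ⟨m, rfl⟩ := Nat.exists_eq_add_of_lt (Finset.mem_range.1 hk)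
      rw [show 2 ^ (k + m + 1) + j = j + 2 ^ k * (2 * 2 ^ m) by ring,
        Nat.add_mul_div_left _ _ (by positivity), Nat.add_mul_mod_self_left]

theorem sum_alpha (n : ℕ) (i : Fin (2 ^ n)) : (tSeq n).getD i 0 = ∑ h, (alpha n i h).val := by
  rw [getD_tSeq n i i.2, ← Fin.sum_univ_eq_sum_range fun k => i.val / 2 ^ k % 2,
    ← Equiv.sum_comp Fin.revPerm]
  rfl

theorem Diagram.bracketMatrix_apply {n : ℕ} (T : Diagram n) (j : Fin 2) (i : Fin (2 ^ n)) :
    T.bracketMatrix j i = (-Complex.I) ^ (∑ h, (alpha n i h).val) * Complex.I ^ j.val *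
      stateSum T.wiring (fill (alpha n i)) (outer j) := by
  rw [Diagram.bracketMatrix, Matrix.of_apply, sum_alpha, T.bracket_closure]

theorem Diagram.invariantSet_nonempty {n : ℕ} (T : Diagram n) : T.invariantSet.Nonempty := by
  obtain ⟨z, hz, h⟩ := T.exists_mul_stateSum_mem
  choose M hM using fun (j : Fin 2) (i : Fin (2 ^ n)) => h (alpha n i) j
  refine ⟨Matrix.of M, z, hz, ?_⟩
  ext j i
  rw [Matrix.smul_apply, T.bracketMatrix_apply]
  exact hM j i

theorem Diagram.mem_invariantSet_iff {n : ℕ} (T : Diagram n)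
    {M₀ M : Matrix (Fin 2) (Fin (2 ^ n)) ℤ} (h₀ : M₀ ∈ T.invariantSet) :
    M ∈ T.invariantSet ↔ M = M₀ ∨ M = -M₀ := by
  obtain ⟨z₀, hz₀, h₀⟩ := h₀
  change z₀ ^ 8 = 1 at hz₀
  have hz₀' : z₀ ≠ 0 := by rintro rfl; simp at hz₀
  constructor
  · rintro ⟨z, hz, h⟩
    change z ^ 8 = 1 at hz
    have hent : ∀ j i, (M j i : ℂ) = z / z₀ * M₀ j i := fun j i => by
      have h₁ := congrFun (congrFun h j) i
      have h₂ := congrFun (congrFun h₀ j) i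
      simp only [Matrix.map_apply, Matrix.smul_apply, smul_eq_mul] at h₁ h₂
      rw [h₁, h₂]
      field_simp
    have hζ : (z / z₀) ^ 8 = 1 := by rw [div_pow, hz, hz₀, div_one]
    by_cases hM₀ : M₀ = 0
    · left
      ext j i
      have := hent j i
      rw [hM₀] at this
      simpa [hM₀] using this
    · obtain ⟨j, i, hji⟩ : ∃ j i, M₀ j i ≠ 0 := by
        by_contra! hcon
        exact hM₀ (by ext j i; exact hcon j i)
      -- A nonzero entry shows that the ratio of the scalars is rational, and the only rational
      -- eighth roots of unity are `±1`.
      have hζ' : z / z₀ = (((M j i : ℚ) / (M₀ j i : ℚ) : ℚ) : ℂ) := by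
        have : (M₀ j i : ℂ) ≠ 0 := by exact_mod_cast hji
        push_cast
        rw [hent j i, mul_div_cancel_right₀ _ this]
      rw [hζ'] at hζ hent
      have hq : ((M j i : ℚ) / (M₀ j i : ℚ)) ^ 8 = 1 := by exact_mod_cast hζ
      rcases (pow_eq_one_iff_of_ne_zero (by norm_num)).1 hq with hq | ⟨hq, -⟩
      · left
        ext a b
        have := hent a b
        rw [hq, Rat.cast_one, one_mul] at this
        exact_mod_cast this
      · right
        ext a b
        have := hent a b
        rw [hq, Rat.cast_neg, Rat.cast_one, neg_one_mul] at this
        exact_mod_cast this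
  · rintro (rfl | rfl)
    · exact ⟨z₀, hz₀, h₀⟩
    · refine ⟨-z₀, by change (-z₀) ^ 8 = 1; rw [Even.neg_pow (by decide), hz₀], ?_⟩
      rw [neg_smul, ← h₀]
      ext j i
      simp

theorem Isotopic.invariantSet_subset {n : ℕ} {T T' : Diagram n} (h : Isotopic T T') :
    T.invariantSet ⊆ T'.invariantSet := by
  obtain ⟨u, hu, h⟩ := h.exists_stateSum_eq_mul
  have hX : T.bracketMatrix = u • T'.bracketMatrix := by
    ext j i
    rw [Matrix.smul_apply, smul_eq_mul, T.bracketMatrix_apply, T'.bracketMatrix_apply, h]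
    ring
  rintro M ⟨z, hz, hM⟩
  change z ^ 8 = 1 at hz
  refine ⟨z * u, ?_, by rw [hM, hX, smul_smul]⟩
  change (z * u) ^ 8 = 1
  rw [mul_pow, hz, hu, one_mul]

/-- The invariant of a diagram, as a matrix up to sign. -/
noncomputable def Diagram.invariant {n : ℕ} (T : Diagram n) : PM 2 (2 ^ n) :=
  Quotient.mk (signSetoid 2 (2 ^ n)) T.invariantSet_nonempty.some

theorem Diagram.matrices_invariant {n : ℕ} (T : Diagram n) :
    T.invariant.matrices = T.invariantSet := by
  ext M
  rw [T.mem_invariantSet_iff T.invariantSet_nonempty.some_mem]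
  exact Quotient.eq (r := signSetoid 2 (2 ^ n))

/-- One inclusion suffices, since a common representative determines the class. -/
theorem Isotopic.invariant_eq {n : ℕ} {T T' : Diagram n} (h : Isotopic T T') :
    T.invariant = T'.invariant :=
  Quotient.sound ((T'.mem_invariantSet_iff T'.invariantSet_nonempty.some_mem).1
    (h.invariantSet_subset T.invariantSet_nonempty.some_mem))

theorem invariantSet_eq_krebesSet (T : Diagram 0) : T.invariantSet = krebesSet T := by
  have h : ∀ z : ℂ, z • T.bracketMatrix =
      !![z * bracket (ballClosure T 0); Complex.I * z * bracket (ballClosure T 1)] := by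
    intro z
    ext j i
    have hα : alpha 0 i = Fin.elim0 := Subsingleton.elim _ _
    obtain rfl : i = 0 := Subsingleton.elim (α := Fin 1) _ _
    fin_cases j
    · simp [Diagram.bracketMatrix, hα, ballClosure, tSeq]
    · simp [Diagram.bracketMatrix, hα, ballClosure, tSeq]
      ring
  ext M
  exact exists_congr fun z => and_congr_right fun _ => by rw [h]

end PuncturedTangle

theorem theorem3p1 :
    ∃ F : (n : ℕ) → PuncturedTangle.Diagram n → PuncturedTangle.PM 2 (2 ^ n),
      (∀ (n : ℕ) (T : PuncturedTangle.Diagram n), (F n T).matrices = T.invariantSet) ∧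
      (∀ (n : ℕ) (T T' : PuncturedTangle.Diagram n),
        PuncturedTangle.Isotopic T T' → F n T = F n T') ∧
      (∀ B : PuncturedTangle.Diagram 0, (F 0 B).matrices = PuncturedTangle.krebesSet B) :=
  ⟨fun _ T => T.invariant, fun _ T => T.matrices_invariant, fun _ _ _ h => h.invariant_eq,
    fun B => B.matrices_invariant.trans (PuncturedTangle.invariantSet_eq_krebesSet B)⟩
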